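/- Let $\mathcal H$ be a complex Hilbert space of finite dimension $n$ and let $r_1,\dots,r_m$ be natural numbers with $\sum_{i=1}^m r_i=n$. An \emph{ensemble} $\widetilde P=\{p_i,\rho_i\}_{i=1}^m$ consists of probabilities $p_i>0$ with $\sum_i p_i=1$ and density operators $\rho_i\ge 0$, $\operatorname{Tr}\rho_i=1$, on $\mathcal H$. Let $\mathcal E(r_1,\dots,r_m)$ be the set of ensembles of linearly independent states with $\operatorname{rank}\rho_i=r_i$ for all $i$, i.e. such that the supports of $\rho_1,\dots,\rho_m$ are linearly independent subspaces of dimensions $r_1,\dots,r_m$. An $m$-element POVM $\{\Pi_i\}$ ($\Pi_i\ge0$, $\sum_i\Pi_i=\mathbb 1$) is \emph{optimal} for $\widetilde P$ if it maximizes $\sum_i p_i\operatorname{Tr}(\rho_i\Pi_i)$ among all $m$-element POVMs. Let $\mathcal P(r_1,\dots,r_m)$ be the set of POVMs with $\Pi_i\Pi_j=\delta_{ij}\Pi_i$ and $\operatorname{rank}\Pi_i=r_i$, and put $$PGM(\{q_i,\sigma_i\})=\Big\{\big(\textstyle\sum_j q_j\sigma_j\big)^{-1/2}q_i\sigma_i\big(\sum_k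 q_k\sigma_k\big)^{-1/2}\Big\}_{i=1}^m .$$ For $\widetilde P\in\mathcal E(r_1,\dots,r_m)$ construct an ensemble $\widetilde Q=\{q_i,\sigma_i\}$ as follows. Let $\{\Pi_i\}$ be an optimal POVM for $\widetilde P$. Write $p_i\rho_i=\sum_{j=1}^{r_i}|\psi_{ij}\rangle\langle\psi_{ij}|$, let $G$ be the Gram matrix of the vectors $\psi_{ij}$ (an $n\times n$ matrix with blocks of sizes $r_1,\dots,r_m$), and let $u_{ij}$ be the dual system, $\langle\psi_{ij}|u_{kl}\rangle=\delta_{ik}\delta_{jl}$. Choose a unitary matrix $W$ such that the vectors $w_{ij}=\sum_{l,k}(G^{1/2}W)^{(l\,i)}_{k\,j}\,u_{lk}$ satisfy $\Pi_i=\sum_{j=1}^{r_i}|w_{ij}\rangle\langle w_{ij}|$ for all $i$, and such that every diagonal block $X^{(ii)}$ of $G^{1/2}W$ is positive semidefinite. Put $\chi_{ij}=\sum_{k=1}^{r_i}X^{(ii)}_{kj}\psi_{ik}$ and $$\sigma_i=\frac{\sum_{j}|\chi_{ij}\rangle\langle\chi_{ij}|}{\sum_{k}\langle\chi_{ik}|\chi_{ik}\rangle},\qquad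 q_i=\frac{\sum_{j}\langle\chi_{ij}|\chi_{ij}\rangle}{\sum_{l,k}\langle\chi_{lk}|\chi_{lk}\rangle}.$$ \textbf{Theorem.} For every $\widetilde P\in\mathcal E(r_1,\dots,r_m)$ this construction can be carried out, its result $\widetilde Q$ does not depend on the choices made, and $\widetilde Q\in\mathcal E(r_1,\dots,r_m)$; so it defines a map $\mathscr R:\mathcal E(r_1,\dots,r_m)\to\mathcal E(r_1,\dots,r_m)$, $\mathscr R(\widetilde P)=\widetilde Q$. The map $\mathscr R$ is one-to-one, and it is onto, hence a bijection. Moreover, for every $\widetilde P\in\mathcal E(r_1,\dots,r_m)$ the optimal POVM $\mathscr P(\widetilde P)$ is unique, belongs to $\mathcal P(r_1,\dots,r_m)$, and $\mathscr P(\widetilde P)=PGM(\mathscr R(\widetilde P))$. -/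

import Mathlib

open scoped ComplexOrder MatrixOrder

noncomputable section

namespace MED

/-- An ensemble `{p i, ρ i}` of `m` states on the Hilbert space `H`: strictly positive probabilities
`p i` summing to `1`, and density operators `ρ i` (positive operators of trace `1`). -/
@[ext]
structure Ensemble (m : ℕ) (H : Type*) [NormedAddCommGroup H] [InnerProductSpace ℂ H]
    [CompleteSpace H] where
  p : Fin m → ℝ
  ρ : Fin m → (H →L[ℂ] H)
  p_pos : ∀ i, 0 < p i
  sum_p : ∑ i, p i = 1
  ρ_nonneg : ∀ i, 0 ≤ ρ i
  trace_ρ : ∀ i, LinearMap.trace ℂ H (ρ i : H →ₗ[ℂ] H) = 1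

variable {m : ℕ} {H : Type*} [NormedAddCommGroup H] [InnerProductSpace ℂ H] [CompleteSpace H]

/-- `𝓔(r₁, …, r_m)`: the ensembles of linearly independent states whose `i`-th state has rank `r i`.
The support of a positive operator is its range; states are linearly independent when their
supports are linearly independent subspaces. -/
def LIEnsembles (H : Type*) [NormedAddCommGroup H] [InnerProductSpace ℂ H] [CompleteSpace H]
    (r : Fin m → ℕ) : Set (Ensemble m H) :=
  {P | (∀ i, Module.finrank ℂ (LinearMap.range (P.ρ i : H →ₗ[ℂ] H)) = r i) ∧
    iSupIndep fun i => LinearMap.range (P.ρ i : H →ₗ[ℂ] H)}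

/-- An `m`-element POVM on `H`. -/
def IsPOVM (E : Fin m → (H →L[ℂ] H)) : Prop :=
  (∀ i, 0 ≤ E i) ∧ ∑ i, E i = 1

/-- The average probability of success `∑ i, p i * Tr (ρ i * E i)`. -/
def successProb (P : Ensemble m H) (E : Fin m → (H →L[ℂ] H)) : ℝ :=
  ∑ i, P.p i * (LinearMap.trace ℂ H (P.ρ i * E i : H →L[ℂ] H).toLinearMap).re

/-- `E` is an optimal POVM for the minimum error discrimination of `P`: it maximizes the success
probability among all `m`-element POVMs. -/
def IsOptimalPOVM (P : Ensemble m H) (E : Fin m → (H →L[ℂ] H)) : Prop :=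
  IsPOVM E ∧ ∀ F : Fin m → (H →L[ℂ] H), IsPOVM F → successProb P F ≤ successProb P E

/-- `𝓟(r₁, …, r_m)`: the projective measurements whose `i`-th projector has rank `r i`. -/
def ProjMeasurements (H : Type*) [NormedAddCommGroup H] [InnerProductSpace ℂ H] [CompleteSpace H]
    (r : Fin m → ℕ) : Set (Fin m → (H →L[ℂ] H)) :=
  {E | IsPOVM E ∧ (∀ i, Module.finrank ℂ (LinearMap.range (E i : H →ₗ[ℂ] H)) = r i) ∧
    ∀ i j, E i * E j = if i = j then E i else 0}

/-- The average operator `∑ j, q j σ j` of an ensemble. -/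
def Ensemble.avg (Q : Ensemble m H) : H →L[ℂ] H :=
  ∑ j, (Q.p j : ℂ) • Q.ρ j

/-- The pretty good measurement of an ensemble. -/
def PGM (Q : Ensemble m H) (i : Fin m) : H →L[ℂ] H :=
  Q.avg ^ (-(1 / 2) : ℝ) * ((Q.p i : ℂ) • Q.ρ i) * Q.avg ^ (-(1 / 2) : ℝ)

/-- The vectors `χ i j = ∑ k, (X i) k j • ψ i k`, where `X i` is the `i`-th diagonal block of the
block matrix `Y`. -/
def chi {r : Fin m → ℕ} (Y : Matrix ((i : Fin m) × Fin (r i)) ((i : Fin m) × Fin (r i)) ℂ)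
    (ψ : (i : Fin m) × Fin (r i) → H) (i : Fin m) (j : Fin (r i)) : H :=
  ∑ k, Y.blockDiag' i k j • ψ ⟨i, k⟩

/-- The correspondence `P ⟶ Q` between ensembles. The `n × n` matrices are indexed by pairs of a
block index `i` and an intra-block index `j` in `Fin (r i)`. -/
def Corresponds (r : Fin m → ℕ) (P Q : Ensemble m H) : Prop :=
  ∃ (E : Fin m → (H →L[ℂ] H)) (ψ u w : (i : Fin m) × Fin (r i) → H)
    (W Y : Matrix ((i : Fin m) × Fin (r i)) ((i : Fin m) × Fin (r i)) ℂ),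
    -- `E` is the optimal POVM of `P`
    IsOptimalPOVM P E ∧
    -- `ψ` resolves the `p i ρ i` into unnormalized pure states; `u` is the dual system
    (∀ i, (P.p i : ℂ) • P.ρ i = ∑ j, InnerProductSpace.rankOne ℂ (ψ ⟨i, j⟩) (ψ ⟨i, j⟩)) ∧
    (∀ a b, inner ℂ (ψ a) (u b) = if a = b then 1 else 0) ∧
    -- `Y = G ^ (1/2) W` with `G` the Gram matrix of `ψ` and `W` unitary
    W ∈ Matrix.unitaryGroup ((i : Fin m) × Fin (r i)) ℂ ∧
    Y = CFC.sqrt (Matrix.gram ℂ ψ) * W ∧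
    -- the vectors `w` with coefficients `Y` in the system `u` decompose the `E i`
    (∀ b, w b = ∑ a, Y a b • u a) ∧
    (∀ i, E i = ∑ j, InnerProductSpace.rankOne ℂ (w ⟨i, j⟩) (w ⟨i, j⟩)) ∧
    -- the decomposition of `E` is chosen so that the diagonal blocks of `Y` are positive
    (∀ i, (Y.blockDiag' i).PosSemidef) ∧
    -- `Q` is the normalized ensemble built from the vectors `χ`
    (∀ i, Q.ρ i = ((1 / ∑ k, ‖chi Y ψ i k‖ ^ 2 : ℝ) : ℂ) •
      ∑ j, InnerProductSpace.rankOne ℂ (chi Y ψ i j) (chi Y ψ i j)) ∧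
    (∀ i, Q.p i = (∑ j, ‖chi Y ψ i j‖ ^ 2) / ∑ l, ∑ k, ‖chi Y ψ l k‖ ^ 2)

end MED

end

set_option linter.unusedSectionVars false

/-! Write `A i` for the weighted states of `P`. By convex duality, `E` is optimal exactly when some
`Z` satisfies `A i ≤ Z` and `Z * E i = A i * E i` for all `i` (`isOptimalPOVM_iff`). If the supports
of the `A i` are independent of dimensions `r i` adding up to `n`, then `Z` is invertible, so `E i =
Z⁻¹ * A i * E i` has rank at most `r i`. A POVM with such rank bounds is projective, and `E i` is
then the orthogonal projection onto `Z⁻¹` of the support of `A i`, whence uniqueness.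

The Gram-matrix construction is a disguise. The entries of `Y` are the inner products of `ψ` with
`w`, so `χ` is `A i` applied to `w` and `∑ j, |χ⟩⟨χ|` equals `A i * E i * A i = Z * E i * Z`. Hence
the weighted states of `Q` are `c • (Z * E i * Z)` (`Transforms`), which does not depend on the
decompositions. Their sum is `c • Z ^ 2`, so the pretty good measurement of `Q` is `E`.

The transform can be undone: `Q` yields `E` as its PGM and, up to scale, `Z` as the square root of
its average. Then `A i` is the only positive operator of rank `r i` with `A i * E i = Z * E i`
(`eq_of_mul_eq_mul_of_range_le`), which gives injectivity. Such an operator below `Z` always exists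
(`exists_le_mul_eq`), which gives surjectivity. -/

noncomputable section

namespace MED

/-! ### Dimension counting for families of subspaces. -/

section LinearAlgebra

variable {V : Type*} [AddCommGroup V] [Module ℂ V] [FiniteDimensional ℂ V] {m : ℕ}

/-- Subspaces that span and whose dimensions are at most those prescribed by a partition of the
total dimension are independent, and have exactly the prescribed dimensions. -/
theorem finrank_eq_and_iSupIndep_of_iSup_eq_top {K : Fin m → Submodule ℂ V} {r : Fin m → ℕ}
    (hr : ∑ i, r i = Module.finrank ℂ V) (htop : ⨆ i, K i = ⊤)
    (hle : ∀ i, Module.finrank ℂ (K i) ≤ r i) :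
    (∀ i, Module.finrank ℂ (K i) = r i) ∧ iSupIndep K := by
  have hsurj : Function.Surjective (DFinsupp.lsum ℕ fun i => (K i).subtype) := by
    rw [← LinearMap.range_eq_top, ← Submodule.iSup_eq_range_dfinsupp_lsum, htop]
  have hdim : Module.finrank ℂ (Π₀ i, K i) = ∑ i, Module.finrank ℂ (K i) :=
    Module.finrank_directSum ℂ fun i => K i
  have hge : ∑ i, r i ≤ ∑ i, Module.finrank ℂ (K i) := by
    rw [hr, ← hdim]
    exact LinearMap.finrank_le_finrank_of_surjective hsurj
  have heq := (Finset.sum_eq_sum_iff_of_le fun i _ => hle i).1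
    (le_antisymm (Finset.sum_le_sum fun i _ => hle i) hge)
  refine ⟨fun i => heq i (Finset.mem_univ i), ?_⟩
  rw [iSupIndep_iff_dfinsupp_lsum_injective]
  refine (LinearMap.injective_iff_surjective_of_finrank_eq_finrank ?_).2 hsurj
  rw [hdim, ← hr]
  exact Finset.sum_congr rfl heq

/-- Independent subspaces whose dimensions add up to the total dimension span. -/
theorem iSup_eq_top_of_iSupIndep {K : Fin m → Submodule ℂ V} {r : Fin m → ℕ}
    (hr : ∑ i, r i = Module.finrank ℂ V) (hrank : ∀ i, Module.finrank ℂ (K i) = r i)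
    (hind : iSupIndep K) : ⨆ i, K i = ⊤ := by
  have hdim : Module.finrank ℂ (Π₀ i, K i) = ∑ i, Module.finrank ℂ (K i) :=
    Module.finrank_directSum ℂ fun i => K i
  rw [Submodule.iSup_eq_range_dfinsupp_lsum, LinearMap.range_eq_top]
  refine (LinearMap.injective_iff_surjective_of_finrank_eq_finrank ?_).1
    ((iSupIndep_iff_dfinsupp_lsum_injective K).1 hind)
  rw [hdim, ← hr]
  exact Finset.sum_congr rfl fun i _ => hrank i

theorem eq_of_sum_eq_of_iSupIndep {K : Fin m → Submodule ℂ V} (hind : iSupIndep K)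
    {f g : Fin m → V} (hf : ∀ i, f i ∈ K i) (hg : ∀ i, g i ∈ K i) (h : ∑ i, f i = ∑ i, g i)
    (i : Fin m) : f i = g i := by
  have := (iSupIndep_iff_finsetSum_eq_imp_eq K).1 hind
  exact this Finset.univ f g (fun i _ => ⟨hf i, hg i⟩) h i (Finset.mem_univ i)

end LinearAlgebra

/-! ### Ranks, traces and positive operators. -/

section Operators

variable {H : Type*} [NormedAddCommGroup H] [InnerProductSpace ℂ H] [CompleteSpace H]

theorem finrank_range_mul_le_left [FiniteDimensional ℂ H] (A B : H →L[ℂ] H) :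
    Module.finrank ℂ (LinearMap.range (A * B : H →L[ℂ] H).toLinearMap) ≤
      Module.finrank ℂ (LinearMap.range A.toLinearMap) :=
  Submodule.finrank_mono (LinearMap.range_comp_le_range B.toLinearMap A.toLinearMap)

theorem finrank_range_mul_le_right [FiniteDimensional ℂ H] (A B : H →L[ℂ] H) :
    Module.finrank ℂ (LinearMap.range (A * B : H →L[ℂ] H).toLinearMap) ≤
      Module.finrank ℂ (LinearMap.range B.toLinearMap) := by
  have : LinearMap.range (A * B : H →L[ℂ] H).toLinearMap =
    (LinearMap.range B.toLinearMap).map A.toLinearMap :=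
      LinearMap.range_comp B.toLinearMap A.toLinearMap
  rw [this]
  exact Submodule.finrank_map_le _ _

theorem iSup_range_eq_top_of_isUnit {m : ℕ} {A C : Fin m → (H →L[ℂ] H)}
    (h : IsUnit (∑ i, A i * C i)) : ⨆ i, LinearMap.range (A i).toLinearMap = ⊤ := by
  rw [eq_top_iff]
  rintro x -
  obtain ⟨D, hD, -⟩ := isUnit_iff_exists.1 h
  have hx : x = ∑ i, A i (C i (D x)) := by
    have := congrArg (fun T : H →L[ℂ] H => T x) hD
    simpa [_root_.sum_apply] using this.symm
  rw [hx]
  exact Submodule.sum_mem _ fun i _ =>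
    Submodule.mem_iSup_of_mem i (LinearMap.mem_range_self (A i).toLinearMap _)

theorem isUnit_of_ker_eq_bot [FiniteDimensional ℂ H] {Z : H →L[ℂ] H}
    (h : ∀ x, Z x = 0 → x = 0) : IsUnit Z := by
  rw [ContinuousLinearMap.isUnit_iff_bijective]
  have hi : Function.Injective Z.toLinearMap := (injective_iff_map_eq_zero _).2 h
  exact ⟨hi, LinearMap.injective_iff_surjective.1 hi⟩

/-- A family of operators which is complete, in the sense that `∑ i, A i * C i` is invertible for
some `C`, and whose ranks are bounded by a partition of the dimension, has exactly these ranks and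
independent ranges. -/
theorem finrank_range_eq_and_iSupIndep [FiniteDimensional ℂ H] {m : ℕ} {A C : Fin m → (H →L[ℂ] H)}
    {r : Fin m → ℕ} (hr : ∑ i, r i = Module.finrank ℂ H) (h : IsUnit (∑ i, A i * C i))
    (hle : ∀ i, Module.finrank ℂ (LinearMap.range (A i).toLinearMap) ≤ r i) :
    (∀ i, Module.finrank ℂ (LinearMap.range (A i).toLinearMap) = r i) ∧
      iSupIndep fun i => LinearMap.range (A i).toLinearMap :=
  finrank_eq_and_iSupIndep_of_iSup_eq_top hr (iSup_range_eq_top_of_isUnit h) hle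

/-- The real part of the trace of a bounded operator. -/
def reTr (A : H →L[ℂ] H) : ℝ := (LinearMap.trace ℂ H A.toLinearMap).re

@[simp] theorem reTr_zero : reTr (0 : H →L[ℂ] H) = 0 := by simp [reTr]
theorem reTr_add (A B : H →L[ℂ] H) : reTr (A + B) = reTr A + reTr B := by simp [reTr]
theorem reTr_sub (A B : H →L[ℂ] H) : reTr (A - B) = reTr A - reTr B := by simp [reTr]
theorem reTr_smul (c : ℝ) (A : H →L[ℂ] H) : reTr ((c : ℂ) • A) = c * reTr A := by simp [reTr]
theorem reTr_sum {ι : Type*} (s : Finset ι) (A : ι → (H →L[ℂ] H)) :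
    reTr (∑ i ∈ s, A i) = ∑ i ∈ s, reTr (A i) := by simp [reTr, ContinuousLinearMap.toLinearMap_sum]
theorem reTr_mul_comm (A B : H →L[ℂ] H) : reTr (A * B) = reTr (B * A) := by
  have : LinearMap.trace ℂ H (A.toLinearMap * B.toLinearMap) =
    LinearMap.trace ℂ H (B.toLinearMap * A.toLinearMap) := LinearMap.trace_mul_comm ℂ _ _
  exact congrArg Complex.re this

variable [FiniteDimensional ℂ H]

theorem reTr_rankOne (x y : H) : reTr (InnerProductSpace.rankOne ℂ x y) = (inner ℂ y x).re := by
  rw [reTr, InnerProductSpace.trace_rankOne]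

theorem continuous_reTr : Continuous (reTr : (H →L[ℂ] H) → ℝ) := by
  have : Continuous fun A : H →L[ℂ] H =>
      (LinearMap.trace ℂ H ∘ₗ ContinuousLinearMap.coeLM ℂ) A :=
    LinearMap.continuous_of_finiteDimensional _
  exact Complex.continuous_re.comp this

theorem reTr_star_mul_self (D : H →L[ℂ] H) :
    reTr (star D * D) = ∑ i, ‖D (stdOrthonormalBasis ℂ H i)‖ ^ 2 := by
  rw [reTr, LinearMap.trace_eq_sum_inner _ (stdOrthonormalBasis ℂ H), Complex.re_sum]
  refine Finset.sum_congr rfl fun i _ => ?_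
  have : inner ℂ (stdOrthonormalBasis ℂ H i) ((star D * D : H →L[ℂ] H) (stdOrthonormalBasis ℂ H i)) =
    inner ℂ (D (stdOrthonormalBasis ℂ H i)) (D (stdOrthonormalBasis ℂ H i)) := by
      rw [ContinuousLinearMap.star_eq_adjoint, mul_apply_eq_comp,
        ContinuousLinearMap.adjoint_inner_right]
  erw [this, inner_self_eq_norm_sq_to_K]
  norm_cast

theorem reTr_star_mul_self_eq_zero {D : H →L[ℂ] H} (h : reTr (star D * D) = 0) : D = 0 := by
  rw [reTr_star_mul_self, Finset.sum_eq_zero_iff_of_nonneg fun _ _ => by positivity] at h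
  refine ContinuousLinearMap.coe_injective ((stdOrthonormalBasis ℂ H).toBasis.ext fun i => ?_)
  simpa using h i (Finset.mem_univ i)

/-- Cyclicity turns the trace of `A * B` into the squared Hilbert–Schmidt norm of `√A * √B`. Both
its nonnegativity and its vanishing case, the source of complementary slackness, follow. -/
theorem reTr_mul_eq_reTr_star_mul_self {A B : H →L[ℂ] H} (hA : 0 ≤ A) (hB : 0 ≤ B) :
    reTr (A * B) = reTr (star (CFC.sqrt A * CFC.sqrt B) * (CFC.sqrt A * CFC.sqrt B)) := by
  have h1 : star (CFC.sqrt A) = CFC.sqrt A := (CFC.sqrt_nonneg A).isSelfAdjoint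
  have h2 : star (CFC.sqrt B) = CFC.sqrt B := (CFC.sqrt_nonneg B).isSelfAdjoint
  have h3 : star (CFC.sqrt A * CFC.sqrt B) * (CFC.sqrt A * CFC.sqrt B) =
      CFC.sqrt B * (A * CFC.sqrt B) := by
    rw [star_mul, h1, h2]
    conv_rhs => rw [← CFC.sqrt_mul_sqrt_self A hA]
    simp only [mul_assoc]
  rw [h3, reTr_mul_comm (CFC.sqrt B), mul_assoc, CFC.sqrt_mul_sqrt_self B hB]

theorem reTr_mul_nonneg {A B : H →L[ℂ] H} (hA : 0 ≤ A) (hB : 0 ≤ B) : 0 ≤ reTr (A * B) := by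
  rw [reTr_mul_eq_reTr_star_mul_self hA hB, reTr_star_mul_self]
  positivity

theorem mul_eq_zero_of_reTr_mul_eq_zero {A B : H →L[ℂ] H} (hA : 0 ≤ A) (hB : 0 ≤ B)
    (h : reTr (A * B) = 0) : A * B = 0 := by
  rw [reTr_mul_eq_reTr_star_mul_self hA hB] at h
  have h0 := reTr_star_mul_self_eq_zero h
  calc A * B = CFC.sqrt A * (CFC.sqrt A * CFC.sqrt B) * CFC.sqrt B := by
        conv_lhs => rw [← CFC.sqrt_mul_sqrt_self A hA, ← CFC.sqrt_mul_sqrt_self B hB]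
        simp only [mul_assoc]
    _ = 0 := by rw [h0]; simp

/-- A positive operator is determined by its restriction to a subspace on which it has full rank. -/
theorem eq_of_mul_eq_mul_of_range_le {A A' E : H →L[ℂ] H} (hA : 0 ≤ A) (hA' : 0 ≤ A')
    (h : A * E = A' * E)
    (hr : LinearMap.range A.toLinearMap ≤ LinearMap.range (A * E : H →L[ℂ] H).toLinearMap)
    (hr' : LinearMap.range A'.toLinearMap ≤ LinearMap.range (A' * E : H →L[ℂ] H).toLinearMap) :
    A = A' := by
  -- The orthogonal complement of the range of a self-adjoint operator is its kernel.
  have key : ∀ {B : H →L[ℂ] H}, 0 ≤ B → ∀ x, (∀ y, inner ℂ (B y) x = 0) → B x = 0 := by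
    intro B hB x hx
    have hs := (ContinuousLinearMap.nonneg_iff_isPositive B).1 hB
    rw [← inner_self_eq_zero (𝕜 := ℂ), ← hx (B x)]
    exact (hs.inner_left_eq_inner_right (B x) x).symm
  ext x
  obtain ⟨y, hy⟩ := hr (LinearMap.mem_range_self A.toLinearMap x)
  have hy' : A (E y) = A x := hy
  have hAE : A (E y) = A' (E y) := congrArg (fun T : H →L[ℂ] H => T y) h
  have hs := (ContinuousLinearMap.nonneg_iff_isPositive A).1 hA
  -- Every `A' z` has the form `A' (E t) = A (E t)`, and symmetry of `A` moves the test onto `A (x -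
  -- E y) = 0`.
  have h0 : A' (x - E y) = 0 := by
    refine key hA' _ fun z => ?_
    obtain ⟨t, ht⟩ := hr' (LinearMap.mem_range_self A'.toLinearMap z)
    have ht' : A' (E t) = A' z := ht
    have hAt : A (E t) = A' (E t) := congrArg (fun T : H →L[ℂ] H => T t) h
    rw [← ht', ← hAt, hs.inner_left_eq_inner_right, map_sub, hy', sub_self, inner_zero_right]
  rw [map_sub, sub_eq_zero] at h0
  rw [h0, ← hAE, hy']

end Operators

/-! ### Optimality conditions by duality, and existence of an optimal POVM. -/

section Optimality

variable {m : ℕ} {H : Type*} [NormedAddCommGroup H] [InnerProductSpace ℂ H] [CompleteSpace H]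

/-- The weighted states `p i ρ i` of an ensemble. -/
def Ensemble.weighted (P : Ensemble m H) (i : Fin m) : H →L[ℂ] H := (P.p i : ℂ) • P.ρ i

theorem Ensemble.weighted_nonneg (P : Ensemble m H) (i : Fin m) : 0 ≤ P.weighted i :=
  smul_nonneg (by exact_mod_cast (P.p_pos i).le) (P.ρ_nonneg i)

theorem Ensemble.reTr_weighted (P : Ensemble m H) (i : Fin m) : reTr (P.weighted i) = P.p i := by
  rw [weighted, reTr_smul, reTr, P.trace_ρ]; simp

theorem Ensemble.range_weighted (P : Ensemble m H) (i : Fin m) :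
    LinearMap.range (P.weighted i).toLinearMap = LinearMap.range (P.ρ i).toLinearMap :=
  LinearMap.range_smul _ _ (by exact_mod_cast (P.p_pos i).ne')

theorem Ensemble.ext_weighted {P Q : Ensemble m H} (h : ∀ i, P.weighted i = Q.weighted i) :
    P = Q := by
  have hp : P.p = Q.p := by
    ext i
    rw [← P.reTr_weighted, ← Q.reTr_weighted, h]
  refine Ensemble.ext hp (funext fun i => ?_)
  have := h i
  rw [weighted, weighted, hp] at this
  exact smul_right_injective _ (by exact_mod_cast (Q.p_pos i).ne') this

theorem nonempty_of_ensemble (P : Ensemble m H) : Nonempty (Fin m) := by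
  by_contra h
  rw [not_nonempty_iff] at h
  simpa using P.sum_p

theorem successProb_eq (P : Ensemble m H) (E : Fin m → (H →L[ℂ] H)) :
    successProb P E = ∑ i, reTr (P.weighted i * E i) := by
  refine Finset.sum_congr rfl fun i _ => ?_
  rw [Ensemble.weighted, smul_mul_assoc, reTr_smul]
  rfl

/-- The optimality conditions for the discrimination of the weighted states `A`: a Lagrange
multiplier `Z` dominates every `A i`, with complementary slackness. -/
structure IsOptimalWith (A E : Fin m → (H →L[ℂ] H)) (Z : H →L[ℂ] H) : Prop where
  povm : IsPOVM E
  le : ∀ i, A i ≤ Z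
  mul : ∀ i, Z * E i = A i * E i

theorem IsPOVM.sum_reTr {E : Fin m → (H →L[ℂ] H)} (hE : IsPOVM E) (Z : H →L[ℂ] H) :
    ∑ i, reTr (Z * E i) = reTr Z := by
  rw [← reTr_sum, ← Finset.mul_sum, hE.2, mul_one]

variable [FiniteDimensional ℂ H]

theorem IsOptimalWith.sum_reTr_le {A E F : Fin m → (H →L[ℂ] H)} {Z : H →L[ℂ] H}
    (h : IsOptimalWith A E Z) (hF : IsPOVM F) :
    ∑ i, reTr (A i * F i) ≤ ∑ i, reTr (A i * E i) := by
  simp only [← h.mul, h.povm.sum_reTr]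
  rw [← hF.sum_reTr Z]
  refine Finset.sum_le_sum fun i _ => ?_
  have := reTr_mul_nonneg (sub_nonneg.2 (h.le i)) (hF.1 i)
  rw [sub_mul, reTr_sub] at this
  linarith

/-- Complementary slackness: a measurement attaining the dual value `Tr Z` is optimal with
multiplier `Z`. -/
theorem IsOptimalWith.of_sum_reTr_le {A F : Fin m → (H →L[ℂ] H)} {Z : H →L[ℂ] H}
    (hle : ∀ i, A i ≤ Z) (hF : IsPOVM F) (hge : reTr Z ≤ ∑ i, reTr (A i * F i)) :
    IsOptimalWith A F Z := by
  have hnn : ∀ i ∈ Finset.univ, 0 ≤ reTr ((Z - A i) * F i) := fun i _ =>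
    reTr_mul_nonneg (sub_nonneg.2 (hle i)) (hF.1 i)
  have hsum : ∑ i, reTr ((Z - A i) * F i) = 0 := by
    refine le_antisymm ?_ (Finset.sum_nonneg hnn)
    simp only [sub_mul, reTr_sub, Finset.sum_sub_distrib, hF.sum_reTr]
    linarith
  refine ⟨hF, hle, fun i => ?_⟩
  have := mul_eq_zero_of_reTr_mul_eq_zero (sub_nonneg.2 (hle i)) (hF.1 i)
    ((Finset.sum_eq_zero_iff_of_nonneg hnn).1 hsum i (Finset.mem_univ i))
  rwa [sub_mul, sub_eq_zero] at this

/-- Conjugation by `1 - ε K` makes the total `1 - (2 ε - ε ^ 2) K`; the missing weight is handed to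
outcome `j`. This is the variation behind the first-order condition. -/
theorem isPOVM_perturb {E : Fin m → (H →L[ℂ] H)} (hE : IsPOVM E) {K : H →L[ℂ] H} (hK : 0 ≤ K)
    (hKK : K * K = K) (j : Fin m) {ε : ℝ} (h0 : 0 ≤ ε) (h2 : ε ≤ 2) :
    IsPOVM fun i => (1 - (ε : ℂ) • K) * E i * (1 - (ε : ℂ) • K) +
      if i = j then ((2 * ε - ε ^ 2 : ℝ) : ℂ) • K else 0 := by
  have hsa : star (1 - (ε : ℂ) • K) = 1 - (ε : ℂ) • K := by
    have : star K = K := hK.isSelfAdjoint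
    simp [this]
  constructor
  · intro i
    refine add_nonneg ?_ ?_
    · have := star_left_conjugate_nonneg (hE.1 i) (1 - (ε : ℂ) • K)
      rwa [hsa] at this
    · split_ifs
      · exact smul_nonneg (by exact_mod_cast (by nlinarith : (0 : ℝ) ≤ 2 * ε - ε ^ 2)) hK
      · exact le_rfl
  · rw [Finset.sum_add_distrib, ← Finset.sum_mul, ← Finset.mul_sum, hE.2, mul_one]
    simp only [Finset.sum_ite_eq', Finset.mem_univ, if_true]
    simp only [mul_sub, sub_mul, one_mul, mul_one, smul_mul_smul_comm, hKK]
    push_cast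
    module

theorem reTr_mul_rankOne (A : H →L[ℂ] H) (v : H) :
    reTr (A * InnerProductSpace.rankOne ℂ v v) = (inner ℂ v (A v)).re := by
  have : A * InnerProductSpace.rankOne ℂ v v = InnerProductSpace.rankOne ℂ (A v) v :=
    InnerProductSpace.comp_rankOne v v A
  rw [this, reTr_rankOne]

/-- The first-order necessary condition for optimality, tested on a unit vector. -/
theorem inner_le_of_isOptimal {A E : Fin m → (H →L[ℂ] H)} (hA : ∀ i, 0 ≤ A i) (hE : IsPOVM E)
    (hopt : ∀ F, IsPOVM F → ∑ i, reTr (A i * F i) ≤ ∑ i, reTr (A i * E i)) (j : Fin m) (v : H)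
    (hv : ‖v‖ = 1) :
    (inner ℂ v (A j v)).re ≤ (inner ℂ v ((∑ i, A i * E i) v)).re := by
  set K := InnerProductSpace.rankOne ℂ v v with hKdef
  have hK : 0 ≤ K := (ContinuousLinearMap.nonneg_iff_isPositive K).2
    (InnerProductSpace.isPositive_rankOne_self v)
  have hKK : K * K = K := InnerProductSpace.isIdempotentElem_rankOne_self hv
  set a := ∑ i, reTr (A i * E i * K)
  have ha : a = (inner ℂ v ((∑ i, A i * E i) v)).re := by
    rw [← reTr_mul_rankOne, Finset.sum_mul, reTr_sum]
  have ha' : ∑ i, reTr (A i * (K * E i)) = a := by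
    refine Finset.sum_congr rfl fun i _ => ?_
    have h1 : star (A i) = A i := (hA i).isSelfAdjoint
    have h2 : star (E i) = E i := (hE.1 i).isSelfAdjoint
    rw [← mul_assoc, reTr_mul_comm, ← mul_assoc, reTr_mul_rankOne, reTr_mul_rankOne]
    have : E i * A i = star (A i * E i) := by rw [star_mul, h1, h2]
    rw [this, ContinuousLinearMap.star_eq_adjoint, ContinuousLinearMap.adjoint_inner_right,
      ← inner_conj_symm, Complex.conj_re]
  set b := reTr (A j * K)
  have hb : b = (inner ℂ v (A j v)).re := reTr_mul_rankOne _ _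
  set d := ∑ i, reTr (A i * (K * E i * K))
  -- The gain from the perturbation is an exact quadratic in `ε`, whose linear coefficient `2 * (b -
  -- a)` must therefore not be positive.
  have key : ∀ ε : ℝ, 0 ≤ ε → ε ≤ 2 → 2 * ε * (b - a) + ε ^ 2 * (d - b) ≤ 0 := by
    intro ε h0 h2
    have hF := hopt _ (isPOVM_perturb hE hK hKK j h0 h2)
    have hexp : ∀ i, reTr (A i * ((1 - (ε : ℂ) • K) * E i * (1 - (ε : ℂ) • K) +
        if i = j then ((2 * ε - ε ^ 2 : ℝ) : ℂ) • K else 0)) =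
        reTr (A i * E i) - ε * reTr (A i * (K * E i)) - ε * reTr (A i * E i * K) +
          ε ^ 2 * reTr (A i * (K * E i * K)) +
          if i = j then (2 * ε - ε ^ 2) * reTr (A i * K) else 0 := by
      intro i
      have e1 : A i * ((1 - (ε : ℂ) • K) * E i * (1 - (ε : ℂ) • K)) =
          A i * E i - (ε : ℂ) • (A i * (K * E i)) - (ε : ℂ) • (A i * E i * K) +
          ((ε ^ 2 : ℝ) : ℂ) • (A i * (K * E i * K)) := by
        simp only [mul_sub, sub_mul, one_mul, mul_one, smul_mul_assoc, mul_smul_comm, mul_assoc]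
        push_cast
        module
      rw [mul_add, e1]
      split_ifs with h
      · simp only [reTr_add, reTr_sub, reTr_smul, mul_smul_comm]
      · simp only [reTr_add, reTr_sub, reTr_smul, mul_zero, reTr_zero]
    simp only [hexp, Finset.sum_add_distrib, Finset.sum_sub_distrib, ← Finset.mul_sum, ha',
      Finset.sum_ite_eq', Finset.mem_univ, if_true] at hF
    linarith
  rw [← ha, ← hb]
  by_contra! hlt
  set g := b - a
  have hg : 0 < g := sub_pos.2 hlt
  -- With `ε = g / M ≤ 1` the linear term is `2 g ^ 2 / M`, while the quadratic one is at least `-g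
  -- ^ 2 / M`; their sum would be positive.
  set M := |d - b| + g
  have hM : 0 < M := by positivity
  have hε := key (g / M) (by positivity) (by
    rw [div_le_iff₀ hM]; nlinarith [abs_nonneg (d - b)])
  have h3 : (g / M) ^ 2 * (d - b) ≥ -((g / M) ^ 2 * M) := by
    have : -M ≤ d - b := by linarith [neg_abs_le (d - b)]
    nlinarith [sq_nonneg (g / M)]
  have h4 : (g / M) ^ 2 * M = g / M * g := by field_simp
  have h5 : 0 < g / M * g := by positivity
  nlinarith

/-- The multiplier is the Hermitian part of `∑ i, A i * E i`, so self-adjointness of that sum need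
not be known beforehand. The first-order condition, rescaled from unit vectors, gives domination;
its trace is the success value, so `IsOptimalWith.of_sum_reTr_le` supplies slackness. -/
theorem exists_isOptimalWith {A E : Fin m → (H →L[ℂ] H)} (hA : ∀ i, 0 ≤ A i) (hE : IsPOVM E)
    (hopt : ∀ F, IsPOVM F → ∑ i, reTr (A i * F i) ≤ ∑ i, reTr (A i * E i)) :
    ∃ Z, IsOptimalWith A E Z := by
  set Z₀ := ∑ i, A i * E i with hZ₀
  have hre : ∀ v, (inner ℂ v (star Z₀ v)).re = (inner ℂ v (Z₀ v)).re := by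
    intro v
    rw [ContinuousLinearMap.star_eq_adjoint, ContinuousLinearMap.adjoint_inner_right,
      ← inner_conj_symm, Complex.conj_re]
  have hunit := inner_le_of_isOptimal hA hE hopt
  have hall : ∀ j v, (inner ℂ v (A j v)).re ≤ (inner ℂ v (Z₀ v)).re := by
    intro j v
    rcases eq_or_ne v 0 with rfl | hv
    · simp
    · have h1 := hunit j ((‖v‖⁻¹ : ℂ) • v) (norm_smul_inv_norm hv)
      have h2 : ∀ T : H →L[ℂ] H, (inner ℂ ((‖v‖⁻¹ : ℂ) • v) (T ((‖v‖⁻¹ : ℂ) • v))).re =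
          (‖v‖⁻¹) ^ 2 * (inner ℂ v (T v)).re := by
        intro T
        rw [map_smul, inner_smul_left, inner_smul_right, ← mul_assoc, ← Complex.ofReal_inv,
          Complex.conj_ofReal, ← Complex.ofReal_mul, Complex.re_ofReal_mul, sq]
      rw [h2, h2] at h1
      exact le_of_mul_le_mul_left h1 (by positivity)
  refine ⟨((1 / 2 : ℝ) : ℂ) • (Z₀ + star Z₀), IsOptimalWith.of_sum_reTr_le ?_ hE ?_⟩
  · intro j
    rw [← sub_nonneg, ContinuousLinearMap.nonneg_iff_isPositive,
      ContinuousLinearMap.isPositive_def']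
    have hj : star (A j) = A j := (hA j).isSelfAdjoint
    refine ⟨?_, fun v => ?_⟩
    · rw [IsSelfAdjoint, star_sub, star_smul, star_add, star_star, hj, add_comm (star Z₀)]
      simp
    · rw [ContinuousLinearMap.reApplyInnerSelf_apply, ← inner_conj_symm]
      simp only [RCLike.conj_re, RCLike.re_to_complex]
      simp only [_root_.sub_apply, _root_.smul_apply,
        _root_.add_apply, inner_sub_right, inner_smul_right, inner_add_right,
        Complex.sub_re, Complex.re_ofReal_mul, Complex.add_re, hre]
      linarith [hall j v]
  · have : reTr (star Z₀) = reTr Z₀ := by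
      rw [hZ₀, star_sum, reTr_sum, reTr_sum]
      refine Finset.sum_congr rfl fun i _ => ?_
      have h1 : star (A i) = A i := (hA i).isSelfAdjoint
      have h2 : star (E i) = E i := (hE.1 i).isSelfAdjoint
      rw [star_mul, h1, h2, reTr_mul_comm]
    rw [reTr_smul, reTr_add, this, ← reTr_sum]
    linarith

theorem isOptimalPOVM_iff (P : Ensemble m H) (E : Fin m → (H →L[ℂ] H)) :
    IsOptimalPOVM P E ↔ ∃ Z, IsOptimalWith P.weighted E Z := by
  constructor
  · rintro ⟨hE, hopt⟩
    simp only [successProb_eq] at hopt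
    exact exists_isOptimalWith P.weighted_nonneg hE hopt
  · rintro ⟨Z, hZ⟩
    refine ⟨hZ.povm, fun F hF => ?_⟩
    simp only [successProb_eq]
    exact hZ.sum_reTr_le hF

theorem isCompact_setOf_isPOVM : IsCompact {E : Fin m → (H →L[ℂ] H) | IsPOVM E} := by
  have : ProperSpace (H →L[ℂ] H) := FiniteDimensional.proper ℂ _
  refine Metric.isCompact_of_isClosed_isBounded ?_ ?_
  · refine IsClosed.inter (s₁ := {E : Fin m → (H →L[ℂ] H) | ∀ i, 0 ≤ E i})
      (s₂ := {E : Fin m → (H →L[ℂ] H) | ∑ i, E i = 1}) ?_ ?_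
    · rw [Set.ofPred_forall]
      exact isClosed_iInter fun i => isClosed_le continuous_const (continuous_apply i)
    · exact isClosed_eq (continuous_finsetSum _ fun i _ => continuous_apply i) continuous_const
  · refine isBounded_iff_forall_norm_le.2 ⟨‖(1 : H →L[ℂ] H)‖, fun E hE => ?_⟩
    refine (pi_norm_le_iff_of_nonneg (norm_nonneg _)).2 fun i => ?_
    refine CStarAlgebra.norm_le_norm_of_nonneg_of_le (hE.1 i) ?_
    rw [← hE.2]
    exact Finset.single_le_sum (fun j _ => hE.1 j) (Finset.mem_univ i)

theorem exists_isOptimalPOVM (P : Ensemble m H) : ∃ E, IsOptimalPOVM P E := by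
  have hne : {E : Fin m → (H →L[ℂ] H) | IsPOVM E}.Nonempty := by
    obtain ⟨i⟩ := nonempty_of_ensemble P
    refine ⟨Pi.single i 1, fun j => ?_, by simp⟩
    by_cases h : j = i
    · subst h; simp
    · simp [Pi.single_eq_of_ne h]
  have hc : Continuous (successProb P) := by
    have : successProb P = fun E => ∑ i, reTr (P.weighted i * E i) :=
      funext fun E => successProb_eq P E
    rw [this]
    exact continuous_finsetSum _ fun i _ =>
      continuous_reTr.comp (continuous_const.mul (continuous_apply i))
  obtain ⟨E, hE, hmax⟩ := isCompact_setOf_isPOVM.exists_isMaxOn hne hc.continuousOn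
  exact ⟨E, hE, fun F hF => hmax hF⟩

end Optimality

/-! ### Linearly independent states: projectivity and uniqueness of the optimum. -/

variable {m : ℕ} {H : Type*} [NormedAddCommGroup H] [InnerProductSpace ℂ H] [CompleteSpace H]
  [FiniteDimensional ℂ H] {r : Fin m → ℕ}

/-- A measurement whose ranks are bounded by a partition of the dimension is projective. -/
theorem IsPOVM.mem_projMeasurements {E : Fin m → (H →L[ℂ] H)} (hE : IsPOVM E)
    (hr : ∑ i, r i = Module.finrank ℂ H)
    (hle : ∀ i, Module.finrank ℂ (LinearMap.range (E i).toLinearMap) ≤ r i) :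
    E ∈ ProjMeasurements H r := by
  obtain ⟨hrank, hind⟩ := finrank_range_eq_and_iSupIndep (A := E) (C := fun _ => 1) hr
    (by simp [hE.2]) hle
  refine ⟨hE, hrank, fun i j => ?_⟩
  ext x
  have hsum : ∑ k, E k (E j x) = ∑ k, (if k = j then E j x else 0) := by
    have := congrArg (fun T : H →L[ℂ] H => T (E j x)) hE.2
    simpa [_root_.sum_apply] using this
  -- `E j x` is decomposed along the independent ranges in two ways: by `∑ k, E k = 1`, and
  -- trivially, as its own `j`-th component.
  have := eq_of_sum_eq_of_iSupIndep hind (f := fun k => E k (E j x))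
    (g := fun k => if k = j then E j x else 0)
    (fun k => LinearMap.mem_range_self (E k).toLinearMap _) (fun k => by
      split_ifs with h
      · subst h; exact LinearMap.mem_range_self (E k).toLinearMap _
      · exact Submodule.zero_mem _) hsum i
  rw [mul_apply_eq_comp, this]
  split_ifs with h
  · rw [h]
  · simp

theorem mem_LIEnsembles_iff (P : Ensemble m H) : P ∈ LIEnsembles H r ↔
    (∀ i, Module.finrank ℂ (LinearMap.range (P.weighted i).toLinearMap) = r i) ∧
      iSupIndep fun i => LinearMap.range (P.weighted i).toLinearMap := by
  have h : (fun i => LinearMap.range (P.weighted i).toLinearMap) =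
      fun i => LinearMap.range (P.ρ i).toLinearMap := funext P.range_weighted
  have h' : ∀ i, Module.finrank ℂ (LinearMap.range (P.weighted i).toLinearMap) =
      Module.finrank ℂ (LinearMap.range (P.ρ i).toLinearMap) := fun i => by rw [P.range_weighted]
  rw [h]
  simp only [h']
  rfl

theorem IsOptimalWith.nonneg {P : Ensemble m H} {E : Fin m → (H →L[ℂ] H)} {Z : H →L[ℂ] H}
    (h : IsOptimalWith P.weighted E Z) : 0 ≤ Z :=
  let ⟨i⟩ := nonempty_of_ensemble P
  (P.weighted_nonneg i).trans (h.le i)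

theorem apply_eq_zero_of_inner_eq_zero {A : H →L[ℂ] H} (hA : 0 ≤ A) {v : H}
    (h : (inner ℂ v (A v)).re = 0) : A v = 0 := by
  have hs : star (CFC.sqrt A) = CFC.sqrt A := (CFC.sqrt_nonneg A).isSelfAdjoint
  have hv : inner ℂ v (A v) = inner ℂ (CFC.sqrt A v) (CFC.sqrt A v) := by
    conv_lhs => rw [← CFC.sqrt_mul_sqrt_self A hA, mul_apply_eq_comp]
    conv_rhs => rw [← ContinuousLinearMap.adjoint_inner_right,
      ← ContinuousLinearMap.star_eq_adjoint, hs]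
  have h0 : CFC.sqrt A v = 0 := by
    rw [hv] at h
    have h' : RCLike.re (inner ℂ (CFC.sqrt A v) (CFC.sqrt A v)) = 0 := h
    rw [inner_self_eq_norm_sq] at h'
    simpa using h'
  rw [← CFC.sqrt_mul_sqrt_self A hA, mul_apply_eq_comp, h0, map_zero]

/-- A vector killed by `Z` is killed by each smaller positive operator `P.weighted i`, hence is
orthogonal to all the supports, which span. -/
theorem isUnit_of_weighted_le {P : Ensemble m H} (hr : ∑ i, r i = Module.finrank ℂ H)
    (hP : P ∈ LIEnsembles H r) {Z : H →L[ℂ] H} (h : ∀ i, P.weighted i ≤ Z) : IsUnit Z := by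
  obtain ⟨hrank, hind⟩ := (mem_LIEnsembles_iff P).1 hP
  have htop := iSup_eq_top_of_iSupIndep hr hrank hind
  refine isUnit_of_ker_eq_bot fun v hv => ?_
  have hAv : ∀ i, P.weighted i v = 0 := by
    intro i
    refine apply_eq_zero_of_inner_eq_zero (P.weighted_nonneg i) (le_antisymm ?_ ?_)
    · have := ((ContinuousLinearMap.nonneg_iff_isPositive _).1
        (sub_nonneg.2 (h i))).re_inner_nonneg_right v
      simp only [_root_.sub_apply, hv, zero_sub, inner_neg_right, map_neg] at this
      simpa using this
    · exact ((ContinuousLinearMap.nonneg_iff_isPositive _).1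
        (P.weighted_nonneg i)).re_inner_nonneg_right v
  have hle : ⨆ i, LinearMap.range (P.weighted i).toLinearMap ≤ (ℂ ∙ v)ᗮ := by
    refine iSup_le fun i => ?_
    rintro _ ⟨x, rfl⟩
    rw [Submodule.mem_orthogonal_singleton_iff_inner_right]
    have hs := (ContinuousLinearMap.nonneg_iff_isPositive _).1 (P.weighted_nonneg i)
    have := hs.inner_left_eq_inner_right v x
    rw [hAv i, inner_zero_left] at this
    exact this.symm
  rw [htop] at hle
  have := hle (Submodule.mem_top : v ∈ ⊤)
  rwa [Submodule.mem_orthogonal_singleton_iff_inner_right, inner_self_eq_zero] at this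

theorem IsOptimalWith.isUnit {P : Ensemble m H} (hr : ∑ i, r i = Module.finrank ℂ H)
    (hP : P ∈ LIEnsembles H r) {E : Fin m → (H →L[ℂ] H)} {Z : H →L[ℂ] H}
    (h : IsOptimalWith P.weighted E Z) : IsUnit Z :=
  isUnit_of_weighted_le hr hP h.le

theorem IsOptimalWith.mem_projMeasurements {P : Ensemble m H}
    (hr : ∑ i, r i = Module.finrank ℂ H) (hP : P ∈ LIEnsembles H r)
    {E : Fin m → (H →L[ℂ] H)} {Z : H →L[ℂ] H} (h : IsOptimalWith P.weighted E Z) :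
    E ∈ ProjMeasurements H r := by
  refine h.povm.mem_projMeasurements hr fun i => ?_
  obtain ⟨Y, -, hY⟩ := isUnit_iff_exists.1 (h.isUnit hr hP)
  have hEi : E i = Y * (P.weighted i * E i) := by rw [← h.mul, ← mul_assoc, hY, one_mul]
  rw [hEi, ← ((mem_LIEnsembles_iff P).1 hP).1 i]
  exact (finrank_range_mul_le_right _ _).trans (finrank_range_mul_le_left _ _)

/-- For linearly independent states the multiplier determines the optimal measurement. -/
theorem IsOptimalWith.unique {P : Ensemble m H}
    (hr : ∑ i, r i = Module.finrank ℂ H) (hP : P ∈ LIEnsembles H r)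
    {E F : Fin m → (H →L[ℂ] H)} {Z : H →L[ℂ] H} (hE : IsOptimalWith P.weighted E Z)
    (hF : IsOptimalWith P.weighted F Z) : E = F := by
  obtain ⟨Y, -, hY⟩ := isUnit_iff_exists.1 (hE.isUnit hr hP)
  -- The range of `G i` is `Z⁻¹` of the support of the `i`-th state, the same for every optimal `G`;
  -- orthogonal projections with equal ranges coincide.
  have hrange : ∀ {G : Fin m → (H →L[ℂ] H)}, IsOptimalWith P.weighted G Z → ∀ i,
      LinearMap.range (G i).toLinearMap =
        LinearMap.range (Y * P.weighted i : H →L[ℂ] H).toLinearMap := by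
    intro G hG i
    have hGi : G i = Y * P.weighted i * G i := by
      rw [mul_assoc, ← hG.mul, ← mul_assoc, hY, one_mul]
    refine Submodule.eq_of_le_of_finrank_le ?_ ?_
    · conv_lhs => rw [hGi]
      exact LinearMap.range_comp_le_range _ _
    · rw [(hG.mem_projMeasurements hr hP).2.1 i, ← ((mem_LIEnsembles_iff P).1 hP).1 i]
      exact finrank_range_mul_le_right _ _
  have hmul : ∀ {G G' : Fin m → (H →L[ℂ] H)}, IsOptimalWith P.weighted G Z →
      IsOptimalWith P.weighted G' Z → ∀ i, G i * G' i = G' i := by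
    intro G G' hG hG' i
    ext x
    have hx : G' i x ∈ LinearMap.range (G i).toLinearMap := by
      rw [hrange hG, ← hrange hG']
      exact LinearMap.mem_range_self (G' i).toLinearMap x
    obtain ⟨y, hy⟩ := hx
    have hy' : G i y = G' i x := hy
    have hid := (hG.mem_projMeasurements hr hP).2.2 i i
    rw [if_pos rfl] at hid
    rw [mul_apply_eq_comp, ← hy', ← mul_apply_eq_comp, hid]
  funext i
  have h1 : star (E i) = E i := (hE.povm.1 i).isSelfAdjoint
  have h2 : star (F i) = F i := (hF.povm.1 i).isSelfAdjoint
  calc E i = star (F i * E i) := by rw [hmul hF hE, h1]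
    _ = E i * F i := by rw [star_mul, h1, h2]
    _ = F i := hmul hE hF i

/-- Any optimal `F` attains the dual value `Tr Z`, so it shares the multiplier of `E`. -/
theorem IsOptimalWith.eq_of_isOptimalPOVM {P : Ensemble m H}
    (hr : ∑ i, r i = Module.finrank ℂ H) (hP : P ∈ LIEnsembles H r)
    {E F : Fin m → (H →L[ℂ] H)} {Z : H →L[ℂ] H} (hE : IsOptimalWith P.weighted E Z)
    (hF : IsOptimalPOVM P F) : F = E := by
  refine IsOptimalWith.unique hr hP (.of_sum_reTr_le hE.le hF.1 ?_) hE
  have := hF.2 E hE.povm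
  simp only [successProb_eq, ← hE.mul, hE.povm.sum_reTr] at this
  exact this

theorem IsOptimalWith.multiplier_eq {A E : Fin m → (H →L[ℂ] H)} {Z : H →L[ℂ] H}
    (h : IsOptimalWith A E Z) : Z = ∑ i, A i * E i := by
  simp only [← h.mul, ← Finset.mul_sum, h.povm.2, mul_one]

/-! ### The transform in operator form: well-definedness, PGM, injectivity. -/

/-- The weighted states of `Q` are, up to normalization, the operators `Z * E i * Z` attached to the
optimal measurement `E` of `P` and its multiplier `Z`. -/
structure Transforms (P Q : Ensemble m H) (E : Fin m → (H →L[ℂ] H)) (Z : H →L[ℂ] H) (c : ℝ) :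
    Prop where
  opt : IsOptimalWith P.weighted E Z
  pos : 0 < c
  eq : ∀ i, Q.weighted i = (c : ℂ) • (Z * E i * Z)

/-- The adjoint of the slackness relation replaces the right-hand factor, the relation itself the
left-hand one. This removes the individual states from the construction. -/
theorem IsOptimalWith.conj_eq {P : Ensemble m H} {E : Fin m → (H →L[ℂ] H)} {Z : H →L[ℂ] H}
    (h : IsOptimalWith P.weighted E Z) (i : Fin m) :
    P.weighted i * E i * P.weighted i = Z * E i * Z := by
  have h1 : star (P.weighted i) = P.weighted i := (P.weighted_nonneg i).isSelfAdjoint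
  have h2 : star (E i) = E i := (h.povm.1 i).isSelfAdjoint
  have h3 : star Z = Z := h.nonneg.isSelfAdjoint
  have h4 : E i * Z = E i * P.weighted i := by
    simpa [h1, h2, h3] using congrArg star (h.mul i)
  rw [← h.mul, mul_assoc, mul_assoc, h4]

theorem reTr_pos {B : H →L[ℂ] H} (hB : 0 ≤ B) (h0 : B ≠ 0) : 0 < reTr B := by
  have h1 : (0 : H →L[ℂ] H) ≤ 1 := zero_le_one
  have hnn := reTr_mul_nonneg hB h1
  rw [mul_one] at hnn
  refine lt_of_le_of_ne hnn fun h => h0 ?_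
  have := mul_eq_zero_of_reTr_mul_eq_zero hB h1 (by rw [mul_one, ← h])
  rwa [mul_one] at this

theorem trace_eq_reTr {B : H →L[ℂ] H} (hB : 0 ≤ B) :
    LinearMap.trace ℂ H B.toLinearMap = (reTr B : ℂ) := by
  have h : 0 ≤ LinearMap.trace ℂ H B.toLinearMap := LinearMap.IsPositive.trace_nonneg
    ((ContinuousLinearMap.isPositive_toLinearMap_iff B).2
      ((ContinuousLinearMap.nonneg_iff_isPositive B).1 hB))
  exact (Complex.eq_re_of_ofReal_le h)

/-- Every family of nonzero positive operators normalizes to an ensemble. -/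
theorem exists_ensemble [Nonempty (Fin m)] {B : Fin m → (H →L[ℂ] H)} (hB : ∀ i, 0 ≤ B i)
    (h0 : ∀ i, B i ≠ 0) :
    ∃ (Q : Ensemble m H) (c : ℝ), 0 < c ∧ ∀ i, Q.weighted i = (c : ℂ) • B i := by
  have hpos := fun i => reTr_pos (hB i) (h0 i)
  have hN : 0 < ∑ i, reTr (B i) := Finset.sum_pos (fun i _ => hpos i) Finset.univ_nonempty
  refine ⟨{ p := fun i => reTr (B i) / ∑ j, reTr (B j)
            ρ := fun i => (((reTr (B i))⁻¹ : ℝ) : ℂ) • B i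
            p_pos := fun i => div_pos (hpos i) hN
            sum_p := by rw [← Finset.sum_div, div_self hN.ne']
            ρ_nonneg := fun i => smul_nonneg (by exact_mod_cast (inv_pos.2 (hpos i)).le) (hB i)
            trace_ρ := fun i => ?_ }, (∑ j, reTr (B j))⁻¹, inv_pos.2 hN, fun i => ?_⟩
  · rw [ContinuousLinearMap.toLinearMap_smul, map_smul, trace_eq_reTr (hB i), smul_eq_mul,
      ← Complex.ofReal_mul, inv_mul_cancel₀ (hpos i).ne', Complex.ofReal_one]
  · rw [Ensemble.weighted, smul_smul, ← Complex.ofReal_mul]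
    congr 2
    have := (hpos i).ne'
    field_simp

theorem Ensemble.weighted_ne_zero (P : Ensemble m H) (i : Fin m) : P.weighted i ≠ 0 := by
  intro h
  have := P.reTr_weighted i
  rw [h, reTr_zero] at this
  exact (P.p_pos i).ne this

theorem rank_pos {P : Ensemble m H} (hP : P ∈ LIEnsembles H r) (i : Fin m) : 0 < r i := by
  rw [← ((mem_LIEnsembles_iff P).1 hP).1 i, Nat.pos_iff_ne_zero]
  intro h
  rw [Submodule.finrank_eq_zero, LinearMap.range_eq_bot] at h
  exact P.weighted_ne_zero i (ContinuousLinearMap.coe_injective h)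

theorem isUnit_ofReal_smul {c : ℝ} (hc : c ≠ 0) {Z : H →L[ℂ] H} (hZ : IsUnit Z) :
    IsUnit ((c : ℂ) • Z) := by
  have : (c : ℂ) ≠ 0 := by exact_mod_cast hc
  exact hZ.smul (Units.mk0 _ this)

theorem ProjMeasurements.ne_zero {E : Fin m → (H →L[ℂ] H)} (hE : E ∈ ProjMeasurements H r)
    {i : Fin m} (hi : 0 < r i) : E i ≠ 0 := by
  intro h
  have := hE.2.1 i
  rw [h, ContinuousLinearMap.toLinearMap_zero, LinearMap.range_zero, finrank_bot] at this
  exact hi.ne this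

theorem Transforms.mem_LIEnsembles {P Q : Ensemble m H} {E : Fin m → (H →L[ℂ] H)}
    {Z : H →L[ℂ] H} {c : ℝ} (h : Transforms P Q E Z c) (hr : ∑ i, r i = Module.finrank ℂ H)
    (hP : P ∈ LIEnsembles H r) : Q ∈ LIEnsembles H r := by
  rw [mem_LIEnsembles_iff]
  have hZ := h.opt.isUnit hr hP
  refine finrank_range_eq_and_iSupIndep (C := fun _ => 1) hr ?_ fun i => ?_
  · simp only [mul_one, h.eq, ← Finset.smul_sum, ← Finset.sum_mul, ← Finset.mul_sum, h.opt.povm.2]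
    exact isUnit_ofReal_smul h.pos.ne' (hZ.mul hZ)
  · rw [h.eq, ← mul_smul_comm, ← (h.opt.mem_projMeasurements hr hP).2.1 i]
    exact (finrank_range_mul_le_left _ _).trans (finrank_range_mul_le_right _ _)

theorem exists_transforms {P : Ensemble m H} (hr : ∑ i, r i = Module.finrank ℂ H)
    (hP : P ∈ LIEnsembles H r) : ∃ Q E Z c, Transforms P Q E Z c := by
  obtain ⟨E, hE⟩ := exists_isOptimalPOVM P
  obtain ⟨Z, hZ⟩ := (isOptimalPOVM_iff P E).1 hE
  have := nonempty_of_ensemble P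
  have hu := hZ.isUnit hr hP
  have hs : star Z = Z := hZ.nonneg.isSelfAdjoint
  obtain ⟨Q, c, hc, hQ⟩ := exists_ensemble (B := fun i => Z * E i * Z) (fun i => by
      have := star_left_conjugate_nonneg (hZ.povm.1 i) Z
      rwa [hs] at this) (fun i h => by
      rw [hu.mul_left_eq_zero, hu.mul_right_eq_zero] at h
      exact ProjMeasurements.ne_zero (hZ.mem_projMeasurements hr hP) (rank_pos hP i) h)
  exact ⟨Q, E, Z, c, hZ, hc, hQ⟩

theorem Ensemble.sum_reTr_weighted (P : Ensemble m H) : ∑ i, reTr (P.weighted i) = 1 := by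
  simp only [P.reTr_weighted, P.sum_p]

/-- Ensembles with proportional weighted states coincide. -/
theorem Ensemble.eq_of_weighted_eq_smul {P Q : Ensemble m H} {c : ℝ}
    (h : ∀ i, P.weighted i = (c : ℂ) • Q.weighted i) : P = Q := by
  have hc : c = 1 := by
    have := P.sum_reTr_weighted
    simp only [h, reTr_smul, ← Finset.mul_sum, Q.sum_reTr_weighted, mul_one] at this
    exact this
  refine Ensemble.ext_weighted fun i => ?_
  rw [h, hc, Complex.ofReal_one, one_smul]

theorem Transforms.right_unique {P Q Q' : Ensemble m H} {E E' : Fin m → (H →L[ℂ] H)}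
    {Z Z' : H →L[ℂ] H} {c c' : ℝ} (h : Transforms P Q E Z c) (h' : Transforms P Q' E' Z' c')
    (hr : ∑ i, r i = Module.finrank ℂ H) (hP : P ∈ LIEnsembles H r) : Q = Q' := by
  obtain rfl : E' = E :=
    h.opt.eq_of_isOptimalPOVM hr hP ((isOptimalPOVM_iff P E').2 ⟨Z', h'.opt⟩)
  obtain rfl : Z' = Z := h'.opt.multiplier_eq.trans h.opt.multiplier_eq.symm
  refine Ensemble.eq_of_weighted_eq_smul (c := c / c') fun i => ?_
  rw [h.eq, h'.eq, smul_smul, ← Complex.ofReal_mul, div_mul_cancel₀ _ h'.pos.ne']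

theorem rpow_neg_half_mul {Z : H →L[ℂ] H} (hZ : 0 ≤ Z) (hu : IsUnit Z) :
    (Z * Z) ^ (-(1 / 2) : ℝ) * Z = 1 ∧ Z * (Z * Z) ^ (-(1 / 2) : ℝ) = 1 := by
  have hnn : 0 ≤ Z * Z := by
    have := star_mul_self_nonneg Z
    rwa [(hZ.isSelfAdjoint : star Z = Z)] at this
  have hsp : IsStrictlyPositive (Z * Z) := (hu.mul hu).isStrictlyPositive hnn
  have hsq : (Z * Z) ^ (1 / 2 : ℝ) = Z := by
    rw [← CFC.sqrt_eq_rpow, CFC.sqrt_mul_self Z hZ]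
  have h1 := CFC.rpow_neg_mul_rpow (1 / 2) hsp
  have h2 := CFC.rpow_mul_rpow_neg (1 / 2) hsp
  rw [hsq] at h1 h2
  exact ⟨h1, h2⟩

theorem smul_sqrt_mul (c : ℝ) (hc : 0 ≤ c) (Z E : H →L[ℂ] H) :
    (((√c : ℝ) : ℂ) • Z) * E * (((√c : ℝ) : ℂ) • Z) = (c : ℂ) • (Z * E * Z) := by
  rw [smul_mul_assoc, smul_mul_smul_comm, ← Complex.ofReal_mul, Real.mul_self_sqrt hc]

theorem Transforms.avg_eq {P Q : Ensemble m H} {E : Fin m → (H →L[ℂ] H)}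
    {Z : H →L[ℂ] H} {c : ℝ} (h : Transforms P Q E Z c) :
    Q.avg = (((√c : ℝ) : ℂ) • Z) * (((√c : ℝ) : ℂ) • Z) := by
  have : Q.avg = ∑ i, Q.weighted i := rfl
  rw [this]
  simp only [h.eq, ← Finset.smul_sum, ← Finset.sum_mul, ← Finset.mul_sum, h.opt.povm.2, mul_one]
  rw [smul_mul_smul_comm, ← Complex.ofReal_mul, Real.mul_self_sqrt h.pos.le]

theorem ofReal_sqrt_smul_nonneg (c : ℝ) {Z : H →L[ℂ] H} (hZ : 0 ≤ Z) :
    0 ≤ ((√c : ℝ) : ℂ) • Z :=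
  smul_nonneg (by exact_mod_cast Real.sqrt_nonneg c) hZ

/-- The optimal measurement of an ensemble is the pretty good measurement of its transform. -/
theorem Transforms.pgm_eq {P Q : Ensemble m H} {E : Fin m → (H →L[ℂ] H)}
    {Z : H →L[ℂ] H} {c : ℝ} (h : Transforms P Q E Z c) (hr : ∑ i, r i = Module.finrank ℂ H)
    (hP : P ∈ LIEnsembles H r) : PGM Q = E := by
  funext i
  have hQ : (Q.p i : ℂ) • Q.ρ i = (((√c : ℝ) : ℂ) • Z) * E i * (((√c : ℝ) : ℂ) • Z) := by
    rw [smul_sqrt_mul c h.pos.le, ← h.eq]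
    rfl
  obtain ⟨h1, h2⟩ := rpow_neg_half_mul (ofReal_sqrt_smul_nonneg c h.opt.nonneg)
    (isUnit_ofReal_smul (Real.sqrt_pos.2 h.pos).ne' (h.opt.isUnit hr hP))
  rw [PGM, hQ, h.avg_eq]
  set N := (((√c : ℝ) : ℂ) • Z * ((√c : ℝ) : ℂ) • Z) ^ (-(1 / 2) : ℝ)
  set Y := ((√c : ℝ) : ℂ) • Z
  calc N * (Y * E i * Y) * N = (N * Y) * E i * (Y * N) := by simp only [mul_assoc]
    _ = E i := by rw [h1, h2, one_mul, mul_one]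

theorem IsOptimalWith.range_weighted_le {P : Ensemble m H}
    (hr : ∑ i, r i = Module.finrank ℂ H) (hP : P ∈ LIEnsembles H r)
    {E : Fin m → (H →L[ℂ] H)} {Z : H →L[ℂ] H} (h : IsOptimalWith P.weighted E Z) (i : Fin m) :
    LinearMap.range (P.weighted i).toLinearMap ≤
      LinearMap.range (P.weighted i * E i : H →L[ℂ] H).toLinearMap := by
  refine (Submodule.eq_of_le_of_finrank_le (LinearMap.range_comp_le_range _ _) ?_).ge
  obtain ⟨Y, -, hY⟩ := isUnit_iff_exists.1 (h.isUnit hr hP)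
  have hEi : E i = Y * (P.weighted i * E i) := by rw [← h.mul, ← mul_assoc, hY, one_mul]
  rw [((mem_LIEnsembles_iff P).1 hP).1 i, ← (h.mem_projMeasurements hr hP).2.1 i]
  conv_lhs => rw [hEi]
  exact finrank_range_mul_le_right _ _

theorem range_ofReal_smul {c : ℝ} (hc : c ≠ 0) (A : H →L[ℂ] H) :
    LinearMap.range ((c : ℂ) • A).toLinearMap = LinearMap.range A.toLinearMap :=
  LinearMap.range_smul _ _ (by exact_mod_cast hc)

/-- `Q` determines `E` as its PGM, and uniqueness of positive square roots of `Q.avg` determines `Z`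
up to a positive factor `s`. The values on the range of `E i` then fix each weighted state up to
`s`, and normalization forces `P = P'`. -/
theorem Transforms.left_unique {P P' Q : Ensemble m H} {E E' : Fin m → (H →L[ℂ] H)}
    {Z Z' : H →L[ℂ] H} {c c' : ℝ} (h : Transforms P Q E Z c) (h' : Transforms P' Q E' Z' c')
    (hr : ∑ i, r i = Module.finrank ℂ H) (hP : P ∈ LIEnsembles H r)
    (hP' : P' ∈ LIEnsembles H r) : P = P' := by
  obtain rfl : E = E' := (h.pgm_eq hr hP).symm.trans (h'.pgm_eq hr hP')
  have hc := Real.sqrt_pos.2 h.pos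
  have hc' := Real.sqrt_pos.2 h'.pos
  have hZZ : ((√c : ℝ) : ℂ) • Z = ((√c' : ℝ) : ℂ) • Z' := by
    rw [← CFC.mul_self_eq_mul_self_iff _ _ (ofReal_sqrt_smul_nonneg c h.opt.nonneg)
      (ofReal_sqrt_smul_nonneg c' h'.opt.nonneg), ← h.avg_eq, ← h'.avg_eq]
  set s := √c' / √c
  have hs : 0 < s := div_pos hc' hc
  have hZs : Z = (s : ℂ) • Z' := by
    have h0 : (((√c)⁻¹ : ℝ) : ℂ) • (((√c : ℝ) : ℂ) • Z) = Z := by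
      rw [smul_smul, ← Complex.ofReal_mul, inv_mul_cancel₀ hc.ne', Complex.ofReal_one, one_smul]
    rw [← h0, hZZ, smul_smul, ← Complex.ofReal_mul]
    congr 2
    rw [mul_comm]; rfl
  refine Ensemble.eq_of_weighted_eq_smul (c := s) fun i => ?_
  refine eq_of_mul_eq_mul_of_range_le (E := E i) (P.weighted_nonneg i)
    (smul_nonneg (by exact_mod_cast hs.le) (P'.weighted_nonneg i)) ?_
    (h.opt.range_weighted_le hr hP i) ?_
  · rw [← h.opt.mul, hZs, smul_mul_assoc, smul_mul_assoc, h'.opt.mul]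
  · rw [smul_mul_assoc, range_ofReal_smul hs.ne', range_ofReal_smul hs.ne']
    exact h'.opt.range_weighted_le hr hP' i

/-! ### Surjectivity: reconstructing an ensemble from its transform. -/

theorem isUnit_sqrt {S : H →L[ℂ] H} (hS : 0 ≤ S) (hu : IsUnit S) : IsUnit (CFC.sqrt S) := by
  refine isUnit_of_ker_eq_bot fun x hx => ?_
  obtain ⟨Y, -, hY⟩ := isUnit_iff_exists.1 hu
  have : Y (CFC.sqrt S (CFC.sqrt S x)) = x := by
    rw [← mul_apply_eq_comp (CFC.sqrt S), CFC.sqrt_mul_sqrt_self S hS, ← mul_apply_eq_comp, hY]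
    rfl
  rw [← this, hx, map_zero, map_zero]

/-- A positive operator `A ≤ Z` which agrees with `Z` on the range of `E` and has the same rank. -/
theorem exists_le_mul_eq {Z : H →L[ℂ] H} (hZ : 0 ≤ Z) (E : H →L[ℂ] H) :
    ∃ A : H →L[ℂ] H, 0 ≤ A ∧ A ≤ Z ∧ Z * E = A * E ∧
      Module.finrank ℂ (LinearMap.range A.toLinearMap) ≤
        Module.finrank ℂ (LinearMap.range E.toLinearMap) := by
  set T := CFC.sqrt Z
  have hT : star T = T := (CFC.sqrt_nonneg Z).isSelfAdjoint
  have hTT : T * T = Z := CFC.sqrt_mul_sqrt_self Z hZ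
  -- Compressing to the range of `T * E` between two factors `T = √Z` leaves `T * (T * E) = Z * E`
  -- unchanged, stays below `T * T = Z`, and has rank at most that of `E`.
  set K := LinearMap.range (T * E : H →L[ℂ] H).toLinearMap
  have hp : IsStarProjection K.starProjection := isStarProjection_starProjection
  refine ⟨T * K.starProjection * T, ?_, ?_, ?_, ?_⟩
  · have := star_left_conjugate_nonneg hp.nonneg T
    rwa [hT] at this
  · have := star_left_conjugate_le_conjugate hp.le_one T
    rwa [hT, mul_one, hTT] at this
  · ext x
    have hx : K.starProjection (T (E x)) = T (E x) :=
      Submodule.starProjection_eq_self_iff.2 (LinearMap.mem_range_self (T * E : H →L[ℂ] H).toLinearMap x)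
    simp only [mul_apply_eq_comp, hx, ← hTT]
  · refine (finrank_range_mul_le_left _ _).trans ((finrank_range_mul_le_right _ _).trans ?_)
    rw [Submodule.range_starProjection]
    exact finrank_range_mul_le_right _ _

/-- Here `Z` is the square root of the average of `Q` and `E` is its PGM; `exists_le_mul_eq` builds
states for which `Z` is a multiplier certifying `E`. -/
theorem exists_transforms_to {Q : Ensemble m H} (hr : ∑ i, r i = Module.finrank ℂ H)
    (hQ : Q ∈ LIEnsembles H r) : ∃ P ∈ LIEnsembles H r, ∃ E Z c, Transforms P Q E Z c := by
  have hne := nonempty_of_ensemble Q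
  have hS : 0 ≤ ∑ i, Q.weighted i := Finset.sum_nonneg fun i _ => Q.weighted_nonneg i
  have hSu : IsUnit (∑ i, Q.weighted i) := isUnit_of_weighted_le hr hQ fun i =>
    Finset.single_le_sum (fun j _ => Q.weighted_nonneg j) (Finset.mem_univ i)
  set Z := CFC.sqrt (∑ i, Q.weighted i) with hZdef
  have hZ : 0 ≤ Z := CFC.sqrt_nonneg _
  have hZZ : Z * Z = ∑ i, Q.weighted i := CFC.sqrt_mul_sqrt_self _ hS
  have hZu : IsUnit Z := isUnit_sqrt hS hSu
  have hZs : star Z = Z := hZ.isSelfAdjoint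
  obtain ⟨Y, hY1, hY2⟩ := isUnit_iff_exists.1 hZu
  have hYs : star Y = Y := by
    have h1 : star Y * Z = 1 := by
      have := congrArg star hY1
      rwa [star_mul, star_one, hZs] at this
    calc star Y = star Y * (Z * Y) := by rw [hY1, mul_one]
      _ = Y := by rw [← mul_assoc, h1, one_mul]
  set E : Fin m → (H →L[ℂ] H) := fun i => Y * Q.weighted i * Y
  have hE : IsPOVM E := by
    refine ⟨fun i => ?_, ?_⟩
    · have := star_left_conjugate_nonneg (Q.weighted_nonneg i) Y
      rwa [hYs] at this
    · simp only [E, ← Finset.sum_mul, ← Finset.mul_sum, ← hZZ]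
      rw [← mul_assoc, hY2, one_mul, hY1]
  have hproj : E ∈ ProjMeasurements H r := hE.mem_projMeasurements hr fun i => by
    rw [← ((mem_LIEnsembles_iff Q).1 hQ).1 i]
    exact (finrank_range_mul_le_left _ _).trans (finrank_range_mul_le_right _ _)
  have hconj : ∀ i, Z * E i * Z = Q.weighted i := fun i => by
    calc Z * (Y * Q.weighted i * Y) * Z = (Z * Y) * Q.weighted i * (Y * Z) := by
          simp only [mul_assoc]
      _ = Q.weighted i := by rw [hY1, hY2, one_mul, mul_one]
  choose A hA hAZ hAE hrank using fun i => exists_le_mul_eq hZ (E i)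
  obtain ⟨P, c, hc, hP⟩ := exists_ensemble (B := A) hA fun i h => by
    have h0 := hAE i
    rw [h, zero_mul, hZu.mul_right_eq_zero] at h0
    exact ProjMeasurements.ne_zero hproj (rank_pos hQ i) h0
  have hopt : IsOptimalWith P.weighted E ((c : ℂ) • Z) := by
    refine ⟨hE, fun i => ?_, fun i => ?_⟩
    · rw [hP, ← sub_nonneg, ← smul_sub]
      exact smul_nonneg (by exact_mod_cast hc.le) (sub_nonneg.2 (hAZ i))
    · rw [hP, smul_mul_assoc, smul_mul_assoc, hAE]
  -- Normalizing the `A i` by `c` scales the multiplier by `c`, and the product `Z * E i * Z` by `c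
  -- ^ 2`.
  refine ⟨P, (mem_LIEnsembles_iff P).2 ?_, E, (c : ℂ) • Z, (c ^ 2)⁻¹, hopt, by positivity, ?_⟩
  · refine finrank_range_eq_and_iSupIndep (C := E) hr ?_ fun i => ?_
    · rw [← hopt.multiplier_eq]
      exact isUnit_ofReal_smul hc.ne' hZu
    · rw [hP, range_ofReal_smul hc.ne', ← hproj.2.1 i]
      exact hrank i
  · intro i
    rw [smul_mul_assoc, smul_mul_smul_comm, hconj, smul_smul, ← Complex.ofReal_mul,
      ← Complex.ofReal_mul, ← sq, inv_mul_cancel₀ (by positivity), Complex.ofReal_one, one_smul]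

/-! ### The Gram-matrix construction and its equivalence with the transform. -/

/-- An orthonormal basis of the range of a projection `E` diagonalizing the compression of a
positive operator `Z`. -/
theorem exists_diagonalizing_family {E Z : H →L[ℂ] H} {k : ℕ} (hE : IsStarProjection E)
    (hk : Module.finrank ℂ (LinearMap.range E.toLinearMap) = k) (hZ : 0 ≤ Z) :
    ∃ (f : Fin k → H) (a : Fin k → ℝ), E = ∑ j, InnerProductSpace.rankOne ℂ (f j) (f j) ∧
      (∀ j, ‖f j‖ = 1) ∧ (∀ j, E (f j) = f j) ∧
      ∀ j l, inner ℂ (f j) (Z (f l)) = if j = l then (a j : ℂ) else 0 := by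
  set K := LinearMap.range E.toLinearMap
  have hEK : E = K.starProjection := by
    obtain ⟨U, hU, rfl⟩ := isStarProjection_iff_eq_starProjection.1 hE
    simp only [K, Submodule.range_starProjection]
  have hpos := ((ContinuousLinearMap.nonneg_iff_isPositive Z).1 hZ).orthogonalProjectionOnto_comp K
  set b := hpos.isSymmetric.eigenvectorBasis hk
  refine ⟨fun j => b j, hpos.isSymmetric.eigenvalues hk, ?_, fun j => b.norm_eq_one j,
    fun j => ?_, fun j l => ?_⟩
  · rw [hEK]; exact b.starProjection_eq_sum_rankOne
  · rw [hEK]; exact Submodule.starProjection_eq_self_iff.2 (b j).2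
  · have h1 := hpos.isSymmetric.apply_eigenvectorBasis hk l
    have h2 : inner ℂ (b j) (K.orthogonalProjectionOnto (Z (b l))) =
        inner ℂ (b j : H) (Z (b l)) := Submodule.inner_orthogonalProjectionOnto_eq_of_mem_left _ _
    rw [← h2]
    have h3 : K.orthogonalProjectionOnto (Z (b l)) =
      (hpos.isSymmetric.eigenvalues hk l : ℂ) • b l := h1
    rw [h3, inner_smul_right, OrthonormalBasis.inner_eq_ite]
    split_ifs with h
    · simp [h]
    · simp

/-- Simultaneous pure-state decompositions of a projection `E` and of a positive operator `A`, with
positive semidefinite cross Gram matrix. -/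
theorem exists_posSemidef_decompositions {A E Z : H →L[ℂ] H} {k : ℕ} (hE : IsStarProjection E)
    (hk : Module.finrank ℂ (LinearMap.range E.toLinearMap) = k) (hZ : 0 ≤ Z) (hu : IsUnit Z)
    (hA : 0 ≤ A) (hmul : Z * E = A * E)
    (hrange : LinearMap.range A.toLinearMap ≤ LinearMap.range (A * E : H →L[ℂ] H).toLinearMap) :
    ∃ f ψ : Fin k → H, E = ∑ j, InnerProductSpace.rankOne ℂ (f j) (f j) ∧
      A = ∑ j, InnerProductSpace.rankOne ℂ (ψ j) (ψ j) ∧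
      (Matrix.of fun j l => inner ℂ (ψ j) (f l)).PosSemidef := by
  obtain ⟨f, a, hf, hnorm, hEf, hfa⟩ := exists_diagonalizing_family hE hk hZ
  have hZpos := (ContinuousLinearMap.nonneg_iff_isPositive Z).1 hZ
  have ha : ∀ j, 0 < a j := by
    intro j
    have hj : (inner ℂ (f j) (Z (f j))).re = a j := by rw [hfa, if_pos rfl, Complex.ofReal_re]
    rw [← hj]
    refine lt_of_le_of_ne (hZpos.re_inner_nonneg_right (f j)) fun h0 => ?_
    have hz := apply_eq_zero_of_inner_eq_zero hZ h0.symm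
    obtain ⟨Y, -, hY⟩ := isUnit_iff_exists.1 hu
    have : f j = 0 := by
      have h1 : (Y * Z) (f j) = f j := by rw [hY]; rfl
      rw [← h1, mul_apply_eq_comp, hz, map_zero]
    have h2 := hnorm j
    rw [this, norm_zero] at h2
    exact zero_ne_one h2
  -- The factor `a j ^ (-1/2)` makes the cross Gram matrix diagonal with entries `√(a j)`, and makes
  -- `∑ j, |ψ j⟩⟨ψ j|` agree with `Z`, hence with `A`, on each `f j`.
  set ψ : Fin k → H := fun j => (((√(a j))⁻¹ : ℝ) : ℂ) • Z (f j) with hψ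
  have hsq : ∀ j, 0 < √(a j) := fun j => Real.sqrt_pos.2 (ha j)
  have hinner : ∀ j l, inner ℂ (ψ j) (f l) = if j = l then ((√(a j) : ℝ) : ℂ) else 0 := by
    intro j l
    rw [hψ]
    simp only
    rw [inner_smul_left, hZpos.inner_left_eq_inner_right, hfa, Complex.conj_ofReal]
    split_ifs
    · rw [← Complex.ofReal_mul]
      congr 1
      rw [inv_mul_eq_div, Real.div_sqrt]
    · rw [mul_zero]
  refine ⟨f, ψ, hf, ?_, ?_⟩
  · set A' := ∑ j, InnerProductSpace.rankOne ℂ (ψ j) (ψ j) with hA'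
    have hA'nn : 0 ≤ A' := Finset.sum_nonneg fun j _ =>
      (ContinuousLinearMap.nonneg_iff_isPositive _).2 (InnerProductSpace.isPositive_rankOne_self _)
    have hA'f : ∀ j, A' (f j) = ((√(a j) : ℝ) : ℂ) • ψ j := by
      intro j
      simp [hA', _root_.sum_apply, hinner]
    have hA'Z : ∀ j, A' (f j) = Z (f j) := by
      intro j
      rw [hA'f, hψ]
      simp only
      rw [smul_smul, ← Complex.ofReal_mul, mul_inv_cancel₀ (hsq j).ne', Complex.ofReal_one,
        one_smul]
    refine eq_of_mul_eq_mul_of_range_le hA hA'nn ?_ hrange ?_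
    · rw [← hmul, hf]
      ext x
      simp [_root_.sum_apply, hA'Z]
    · rintro _ ⟨x, rfl⟩
      refine ⟨∑ j, (inner ℂ (ψ j) x * (((√(a j))⁻¹ : ℝ) : ℂ)) • f j, ?_⟩
      change A' (E _) = A' x
      simp only [map_sum, map_smul, hEf, hA'f, smul_smul]
      conv_rhs => rw [hA']
      simp only [_root_.sum_apply, InnerProductSpace.rankOne_apply]
      refine Finset.sum_congr rfl fun j _ => ?_
      rw [mul_assoc, ← Complex.ofReal_mul, inv_mul_cancel₀ (hsq j).ne', Complex.ofReal_one, mul_one]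
  · have : (Matrix.of fun j l => inner ℂ (ψ j) (f l)) =
        Matrix.diagonal fun j => ((√(a j) : ℝ) : ℂ) := by
      ext j l
      rw [Matrix.of_apply, hinner, Matrix.diagonal_apply]
    rw [this, Matrix.posSemidef_diagonal_iff]
    exact fun j => by exact_mod_cast (hsq j).le

theorem sum_rankOne_apply_self {ι : Type*} [Fintype ι] {A : H →L[ℂ] H} (hA : 0 ≤ A) (w : ι → H) :
    ∑ j, InnerProductSpace.rankOne ℂ (A (w j)) (A (w j)) =
      A * (∑ j, InnerProductSpace.rankOne ℂ (w j) (w j)) * A := by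
  have hs := (ContinuousLinearMap.nonneg_iff_isPositive A).1 hA
  ext x
  simp [_root_.sum_apply, hs.inner_left_eq_inner_right]

theorem reTr_sum_rankOne {ι : Type*} [Fintype ι] (w : ι → H) :
    reTr (∑ j, InnerProductSpace.rankOne ℂ (w j) (w j)) = ∑ j, ‖w j‖ ^ 2 := by
  rw [reTr_sum]
  refine Finset.sum_congr rfl fun j _ => ?_
  rw [reTr_rankOne]
  exact inner_self_eq_norm_sq (𝕜 := ℂ) (w j)

theorem chi_eq {P : Ensemble m H} {ψ w : (i : Fin m) × Fin (r i) → H}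
    {Y : Matrix ((i : Fin m) × Fin (r i)) ((i : Fin m) × Fin (r i)) ℂ}
    (hψ : ∀ i, (P.p i : ℂ) • P.ρ i = ∑ j, InnerProductSpace.rankOne ℂ (ψ ⟨i, j⟩) (ψ ⟨i, j⟩))
    (hY : ∀ a b, Y a b = inner ℂ (ψ a) (w b)) (i : Fin m) (j : Fin (r i)) :
    chi Y ψ i j = P.weighted i (w ⟨i, j⟩) := by
  rw [Ensemble.weighted, hψ]
  simp [chi, Matrix.blockDiag'_apply, hY, _root_.sum_apply]

theorem sum_rankOne_chi {P : Ensemble m H} {E : Fin m → (H →L[ℂ] H)} {Z : H →L[ℂ] H}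
    (h : IsOptimalWith P.weighted E Z) {ψ w : (i : Fin m) × Fin (r i) → H}
    {Y : Matrix ((i : Fin m) × Fin (r i)) ((i : Fin m) × Fin (r i)) ℂ}
    (hψ : ∀ i, (P.p i : ℂ) • P.ρ i = ∑ j, InnerProductSpace.rankOne ℂ (ψ ⟨i, j⟩) (ψ ⟨i, j⟩))
    (hY : ∀ a b, Y a b = inner ℂ (ψ a) (w b))
    (hE : ∀ i, E i = ∑ j, InnerProductSpace.rankOne ℂ (w ⟨i, j⟩) (w ⟨i, j⟩)) (i : Fin m) :
    ∑ j, InnerProductSpace.rankOne ℂ (chi Y ψ i j) (chi Y ψ i j) = Z * E i * Z := by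
  simp only [chi_eq hψ hY]
  rw [sum_rankOne_apply_self (P.weighted_nonneg i), ← hE, h.conj_eq]

/-- Once `∑ j, |χ⟩⟨χ|` is identified with `Z * E i * Z`, the ensemble `Q` depends on the choices
only through `E` and `Z`; this is what makes the construction single-valued. -/
theorem Corresponds.exists_transforms {P Q : Ensemble m H} (h : Corresponds r P Q) :
    ∃ E Z c, Transforms P Q E Z c := by
  obtain ⟨E, ψ, u, w, W, Y, hopt, hψ, hu, -, -, hw, hE, -, hρ, hp⟩ := h
  obtain ⟨Z, hZ⟩ := (isOptimalPOVM_iff P E).1 hopt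
  have hY : ∀ a b, Y a b = inner ℂ (ψ a) (w b) := by
    intro a b
    simp [hw, hu]
  set N := ∑ l, ∑ k, ‖chi Y ψ l k‖ ^ 2
  have hN0 : 0 ≤ N := by positivity
  -- Since division by zero yields zero, positivity of `Q.p i` rules out vanishing numerators and
  -- denominators.
  have hne : ∀ i, ∑ j, ‖chi Y ψ i j‖ ^ 2 ≠ 0 ∧ N ≠ 0 := by
    intro i
    have := (Q.p_pos i).ne'
    rw [hp] at this
    exact div_ne_zero_iff.1 this
  obtain ⟨i₀⟩ := nonempty_of_ensemble P
  refine ⟨E, Z, N⁻¹, hZ, inv_pos.2 (lt_of_le_of_ne hN0 (hne i₀).2.symm), fun i => ?_⟩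
  rw [Ensemble.weighted, hρ, hp, sum_rankOne_chi hZ hψ hY hE, smul_smul, ← Complex.ofReal_mul]
  congr 2
  have := (hne i).1
  field_simp

/-- A matrix `Y` with `Y * Yᴴ` equal to the invertible matrix `G` is `G ^ (1/2)` times a unitary. -/
theorem exists_unitary_eq_sqrt_mul {n : Type*} [Fintype n] [DecidableEq n] {G Y : Matrix n n ℂ}
    (hG : G.PosDef) (hY : Y * star Y = G) :
    ∃ W ∈ Matrix.unitaryGroup n ℂ, Y = CFC.sqrt G * W := by
  have hnn : 0 ≤ G := hG.posSemidef.nonneg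
  set S := CFC.sqrt G
  have hSS : S * S = G := CFC.sqrt_mul_sqrt_self G hnn
  have hS : star S = S := (CFC.sqrt_nonneg G).isSelfAdjoint
  have hdet : IsUnit S.det := by
    have := (Matrix.isUnit_iff_isUnit_det _).1 hG.isUnit
    rw [← hSS, Matrix.det_mul] at this
    exact isUnit_of_mul_isUnit_left this
  have hSinv : star S⁻¹ = S⁻¹ := by
    have := Matrix.conjTranspose_nonsing_inv S
    rw [← Matrix.star_eq_conjTranspose, ← Matrix.star_eq_conjTranspose, hS] at this
    exact this
  refine ⟨S⁻¹ * Y, ?_, ?_⟩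
  · rw [Matrix.mem_unitaryGroup_iff, star_mul, hSinv]
    calc S⁻¹ * Y * (star Y * S⁻¹) = S⁻¹ * (Y * star Y) * S⁻¹ := by simp only [mul_assoc]
      _ = (S⁻¹ * S) * (S * S⁻¹) := by rw [hY, ← hSS]; simp only [mul_assoc]
      _ = 1 := by rw [Matrix.nonsing_inv_mul S hdet, Matrix.mul_nonsing_inv S hdet, one_mul]
  · rw [← mul_assoc, Matrix.mul_nonsing_inv S hdet, one_mul]

theorem linearIndependent_of_decomposition {A : Fin m → (H →L[ℂ] H)}
    (hr : ∑ i, r i = Module.finrank ℂ H) (htop : ⨆ i, LinearMap.range (A i).toLinearMap = ⊤)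
    {ψ : (i : Fin m) × Fin (r i) → H}
    (hψ : ∀ i, A i = ∑ j, InnerProductSpace.rankOne ℂ (ψ ⟨i, j⟩) (ψ ⟨i, j⟩)) :
    LinearIndependent ℂ ψ := by
  refine linearIndependent_of_top_le_span_of_card_eq_finrank ?_ (by simp [hr])
  rw [← htop]
  refine iSup_le fun i => ?_
  rintro _ ⟨x, rfl⟩
  rw [hψ]
  simp only [ContinuousLinearMap.coe_coe, _root_.sum_apply, InnerProductSpace.rankOne_apply]
  exact Submodule.sum_mem _ fun j _ =>
    Submodule.smul_mem _ _ (Submodule.subset_span ⟨⟨i, j⟩, rfl⟩)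

theorem Transforms.corresponds {P Q : Ensemble m H} {E : Fin m → (H →L[ℂ] H)}
    {Z : H →L[ℂ] H} {c : ℝ} (h : Transforms P Q E Z c) (hr : ∑ i, r i = Module.finrank ℂ H)
    (hP : P ∈ LIEnsembles H r) : Corresponds r P Q := by
  have hproj := h.opt.mem_projMeasurements hr hP
  have hstar : ∀ i, IsStarProjection (E i) := fun i =>
    ⟨by have := hproj.2.2 i i; rwa [if_pos rfl] at this, (h.opt.povm.1 i).isSelfAdjoint⟩
  choose f φ hf hφ hpsd using fun i => exists_posSemidef_decompositions (hstar i) (hproj.2.1 i)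
    h.opt.nonneg (h.opt.isUnit hr hP) (P.weighted_nonneg i) (h.opt.mul i)
    (h.opt.range_weighted_le hr hP i)
  set ψ : (i : Fin m) × Fin (r i) → H := fun a => φ a.1 a.2
  set w : (i : Fin m) × Fin (r i) → H := fun a => f a.1 a.2
  set Y : Matrix ((i : Fin m) × Fin (r i)) ((i : Fin m) × Fin (r i)) ℂ :=
    Matrix.of fun a b => inner ℂ (ψ a) (w b) with hYdef
  have hY : ∀ a b, Y a b = inner ℂ (ψ a) (w b) := fun _ _ => rfl
  have hψ : ∀ i, (P.p i : ℂ) • P.ρ i =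
      ∑ j, InnerProductSpace.rankOne ℂ (ψ ⟨i, j⟩) (ψ ⟨i, j⟩) := hφ
  have hE : ∀ i, E i = ∑ j, InnerProductSpace.rankOne ℂ (w ⟨i, j⟩) (w ⟨i, j⟩) := hf
  obtain ⟨hrank, hind⟩ := (mem_LIEnsembles_iff P).1 hP
  have hG : (Matrix.gram ℂ ψ).PosDef := Matrix.posDef_gram_of_linearIndependent
    (linearIndependent_of_decomposition hr (iSup_eq_top_of_iSupIndep hr hrank hind) hφ)
  -- `∑ i, E i = 1` is a resolution of the identity by the `w b`; Parseval's identity then gives `Y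
  -- * star Y = G`, which is what makes `W` unitary.
  have hw1 : ∀ x, ∑ b, inner ℂ (w b) x • w b = x := by
    intro x
    rw [Fintype.sum_sigma]
    have := congrArg (fun T : H →L[ℂ] H => T x) h.opt.povm.2
    simpa [_root_.sum_apply, hE] using this
  have hYY : Y * star Y = Matrix.gram ℂ ψ := by
    ext a b
    rw [Matrix.mul_apply, Matrix.gram_apply]
    conv_rhs => rw [← hw1 (ψ b), inner_sum]
    refine Finset.sum_congr rfl fun d _ => ?_
    rw [Matrix.star_apply, hY, hY, inner_smul_right, mul_comm]
    congr 1
    exact inner_conj_symm _ _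
  have hdet : IsUnit Y.det := by
    have := (Matrix.isUnit_iff_isUnit_det _).1 hG.isUnit
    rw [← hYY, Matrix.det_mul] at this
    exact isUnit_of_mul_isUnit_left this
  obtain ⟨W, hW, hYW⟩ := exists_unitary_eq_sqrt_mul hG hYY
  have hB := sum_rankOne_chi h.opt hψ hY hE
  have hn : ∀ i, Q.p i = c * ∑ j, ‖chi Y ψ i j‖ ^ 2 := by
    intro i
    rw [← Q.reTr_weighted, h.eq, reTr_smul, ← hB, reTr_sum_rankOne]
  have hN : 1 = c * ∑ i, ∑ j, ‖chi Y ψ i j‖ ^ 2 := by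
    rw [Finset.mul_sum, ← Q.sum_p]
    exact Finset.sum_congr rfl fun i _ => hn i
  -- As `Y` is the matrix of inner products of `ψ` with `w`, the columns of `Y⁻¹` are the
  -- coordinates of the dual system of `ψ` in `w`.
  refine ⟨E, ψ, fun b => ∑ d, Y⁻¹ d b • w d, w, W, Y, (isOptimalPOVM_iff P E).2 ⟨Z, h.opt⟩, hψ,
    ?_, hW, hYW, ?_, hE, hpsd, ?_, ?_⟩
  · intro a b
    have := congrFun (congrFun (Matrix.mul_nonsing_inv Y hdet) a) b
    rw [Matrix.mul_apply, Matrix.one_apply] at this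
    rw [← this, inner_sum]
    refine Finset.sum_congr rfl fun d _ => ?_
    rw [inner_smul_right, hY, mul_comm]
  · intro b
    simp only [Finset.smul_sum, smul_smul]
    rw [Finset.sum_comm]
    have : ∀ d, ∑ a, (Y a b * Y⁻¹ d a) • w d = (if d = b then (1 : ℂ) else 0) • w d := by
      intro d
      have := congrFun (congrFun (Matrix.nonsing_inv_mul Y hdet) d) b
      rw [Matrix.mul_apply, Matrix.one_apply] at this
      rw [← Finset.sum_smul, ← this]
      congr 1
      exact Finset.sum_congr rfl fun a _ => mul_comm _ _
    simp [this]
  · intro i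
    have hpi : (Q.p i : ℂ) ≠ 0 := by exact_mod_cast (Q.p_pos i).ne'
    refine smul_right_injective _ hpi ?_
    change Q.weighted i = _
    rw [h.eq, hB]
    simp only
    rw [smul_smul, ← Complex.ofReal_mul]
    congr 2
    have h0 : ∑ j, ‖chi Y ψ i j‖ ^ 2 ≠ 0 := fun h0 => (Q.p_pos i).ne' (by rw [hn, h0, mul_zero])
    rw [hn]
    field_simp
  · intro i
    have h0 : ∑ l, ∑ j, ‖chi Y ψ l j‖ ^ 2 ≠ 0 := fun h0 => by
      rw [h0, mul_zero] at hN
      exact one_ne_zero hN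
    rw [hn, eq_div_iff h0, mul_right_comm, ← hN, one_mul]

end MED

end

/-! ### Assembly of the bijection. -/

theorem mainTheorem2 {H : Type*} [NormedAddCommGroup H] [InnerProductSpace ℂ H] [CompleteSpace H]
    [FiniteDimensional ℂ H] {m : ℕ} (r : Fin m → ℕ) (hr : ∑ i, r i = Module.finrank ℂ H) :
    ∃ R : MED.LIEnsembles H r → MED.LIEnsembles H r,
      (∀ (P : MED.LIEnsembles H r) (Q : MED.Ensemble m H),
        MED.Corresponds r P.1 Q ↔ Q = (R P).1) ∧
      Function.Injective R ∧
      Function.Surjective R ∧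
      ∀ P : MED.LIEnsembles H r,
        MED.PGM (R P).1 ∈ MED.ProjMeasurements H r ∧
        ∀ E : Fin m → (H →L[ℂ] H), MED.IsOptimalPOVM P.1 E ↔ E = MED.PGM (R P).1 := by
  choose T E Z c hT using fun P : MED.LIEnsembles H r => MED.exists_transforms hr P.2
  refine ⟨fun P => ⟨T P, (hT P).mem_LIEnsembles hr P.2⟩, fun P Q => ⟨fun h => ?_, ?_⟩,
    fun P P' h => ?_, fun Q => ?_, fun P => ?_⟩
  · obtain ⟨E', Z', c', h'⟩ := h.exists_transforms
    exact h'.right_unique (hT P) hr P.2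
  · rintro rfl
    exact (hT P).corresponds hr P.2
  · have hQ : T P = T P' := congrArg Subtype.val h
    have h' := hT P'
    rw [← hQ] at h'
    exact Subtype.ext ((hT P).left_unique h' hr P.2 P'.2)
  · obtain ⟨P, hP, E', Z', c', h'⟩ := MED.exists_transforms_to hr Q.2
    exact ⟨⟨P, hP⟩, Subtype.ext ((hT ⟨P, hP⟩).right_unique h' hr hP)⟩
  · have hpgm := (hT P).pgm_eq hr P.2
    simp only [hpgm]
    refine ⟨(hT P).opt.mem_projMeasurements hr P.2, fun F => ⟨fun hF => ?_, ?_⟩⟩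
    · exact (hT P).opt.eq_of_isOptimalPOVM hr P.2 hF
    · rintro rfl
      exact (MED.isOptimalPOVM_iff P.1 _).2 ⟨Z P, (hT P).opt⟩
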